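/- Let $q\in\mathbb C$ with $|q|=1$ be not a nontrivial root of unity, $\lambda=q-q^{-1}$, $[n]_q=\frac{q^n-q^{-n}}{q-q^{-1}}$ (with $[n]_1=n$), $[s]_q!=[s]_q\cdots[1]_q$, $[0]_q!=1$, $1/\Gamma_q(p)=1/[p-1]_q!$ for integers $p\ge1$ and $1/\Gamma_q(p)=0$ for integers $p\le 0$. **Momenta.** Let $k_v,k_-,k_+,k_{\bar v}$ be non-commuting momenta on the $q$-cone, i.e. generators of the complex algebra with relations $$k_\pm k_v=q^{\pm1}k_vk_\pm,\quad k_\pm k_{\bar v}=q^{\pm1}k_{\bar v}k_\pm,\quad k_+k_--k_-k_+=\lambda k_vk_{\bar v},\quad k_{\bar v}k_v=k_vk_{\bar v},\quad k_-k_+=q^{-1}k_vk_{\bar v}.$$ **Fields.** Fields are formal power series in the basis elements $v^jx_-^nx_+^\ell\bar v^m z^a\bar z^b$, whose coefficients are formal power series in these momenta; the momenta commute with $v,x_\pm,\bar v,z,\bar z$. For a variable $\kappa\in\{v,-,+,\bar v,z,\bar z\}$ the following operators act on the basis elements: $\hat M_\kappa$ raises the exponent of $\kappa$ by $1$; $N_\kappa$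 multiplies by the exponent of $\kappa$; $T_\kappa=q^{N_\kappa}$; and $\hat{\mathcal D}_\kappa=\frac1\lambda\hat M_\kappa^{-1}(T_\kappa-T_\kappa^{-1})$ (for $q=1$: $\partial_\kappa$), so that $\hat{\mathcal D}_\kappa$ multiplies by $[N_\kappa]_q$ and then lowers the exponent by $1$. The $q$-Maxwell operators (the case $n=0$ of the $q$-Maxwell hierarchy) are $$\begin{aligned}{}_qI^+_0=\tfrac12\Big(&\big(q\hat{\mathcal D}_v+\hat M_{\bar z}\hat{\mathcal D}_+(T_-T_v)^{-1}T_{\bar v}\big)T_-[2-N_z]_q\\&-q^{-2}\big(\hat{\mathcal D}_-T_-+q^{-1}\hat M_{\bar z}\hat{\mathcal D}_{\bar v}-\lambda\hat M_v\hat M_{\bar z}\hat{\mathcal D}_-\hat{\mathcal D}_+T_{\bar v}\big)T_-^{-1}\hat{\mathcal D}_z\Big)T_+T_vT_zT_{\bar z}^{-1},\end{aligned}$$ $$\begin{aligned}{}_qI^-_0=\ &\tfrac12\big(\hat{\mathcal D}_{\bar v}+q\hat M_z\hat{\mathcal D}_+T_{\bar v}T_-T_v^{-1}-q\lambda\hat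 M_v\hat{\mathcal D}_-\hat{\mathcal D}_+T_{\bar v}\big)T_{\bar v}[2-N_{\bar z}]_q\\&-\tfrac12q^3\big(\hat{\mathcal D}_-+q\hat M_z\hat{\mathcal D}_vT_-\big)\hat{\mathcal D}_{\bar z}T_-T_{\bar v}.\end{aligned}$$ **$q$-plane wave.** Let $\exp_q(k,x)=\sum_{s\ge0}\frac1{[s]_q!}f_s$, where $$f_s=\beta^s\sum_{a,b,n\ge0}\frac{(-1)^{s-a-b}\,q^{\,n(s-2a-2b+2n)+a(s-a-1)+b(-s+a+b+1)}}{\Gamma_q(a-n+1)\Gamma_q(b-n+1)\Gamma_q(s-a-b+n+1)[n]_q!}\;k_v^{s-a-b+n}k_-^{b-n}k_+^{a-n}k_{\bar v}^n\;v^nx_-^{a-n}x_+^{b-n}\bar v^{s-a-b+n},$$ $$(\beta^s)^{-1}=\sum_{p=0}^s\frac{q^{(s-p)(p-1)+p}}{[p]_q!\,[s-p]_q!}$$ ($s$ is an upper index of $\beta$; should the last sum vanish for some $s$, $\beta^s$ is read as $0$). **Coefficient polynomials.** For complex constants $\hat p^{ms1}_{ij},\hat p^{ms2}_i,\hat p^{ms3}_{ij}$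 and $\hat r^{ms1}_{ij},\hat r^{ms2}_i,\hat r^{ms3}_{ij}$ let $$\begin{aligned}\hat F^{h+}_{ms}=\sum_{i=0}^m\Big(&\sum_{j=0}^{m-i}\hat p^{ms1}_{ij}k_v^ik_-^{m-i-j}k_{\bar v}^j(k_v-q^{s+6}zk_-)(k_v-q^{s+3}zk_-)\\&+\hat p^{ms2}_ik_v^ik_{\bar v}^{m-i}(k_v-q^{s+6}zk_-)(k_+-q^{s+3}zk_{\bar v})\\&+\sum_{j=0}^{m-i}\hat p^{ms3}_{ij}k_v^ik_+^{m-i-j}k_{\bar v}^j(k_+-q^{s+6}zk_{\bar v})(k_+-q^{s+3}zk_{\bar v})\Big),\end{aligned}$$ $$\begin{aligned}\hat F^{h-}_{ms}=\sum_{i=0}^m\Big(&\sum_{j=0}^{m-i}\hat r^{ms1}_{ij}k_v^ik_-^{m-i-j}k_{\bar v}^j(k_{\bar v}-q^{-1}\bar zk_-)(k_{\bar v}-\bar zk_-)\\&+\hat r^{ms2}_ik_v^ik_{\bar v}^{m-i}(k_+-q^{-1}\bar zk_v)(k_{\bar v}-\bar zk_-)\\&+\sum_{j=0}^{m-i}\hat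 r^{ms3}_{ij}k_v^ik_+^{m-i-j}k_{\bar v}^j(k_+-q^{-1}\bar zk_v)(k_+-\bar zk_v)\Big).\end{aligned}$$ **Claim.** For every choice of the constants (all of them arbitrary and independent of each other), the formal sums $$\hat F^{h\pm}=\sum_{m,s=0}^\infty\frac1{[s]_q!}\,\hat F^{h\pm}_{ms}(k)\,f_s$$ are well defined (only finitely many terms contribute to each basis element and each degree in the momenta) and solve the homogeneous $q$-Maxwell equations ${}_qI^+_0\hat F^{h+}=0$ and ${}_qI^-_0\hat F^{h-}=0$. If moreover the $\hat r$ do not depend on $s$, then $\hat F^{h-}_{ms}=:\hat F^{h-}_m$ does not depend on $s$, the formal sums below are well defined in the same sense, and $$\hat F^{h-}=\sum_{m=0}^\infty\hat F^{h-}_m(k)\,\exp_q(k,x)=\Big(\sum_{m=0}^\infty\hat F^{h-}_m(k)\Big)\exp_q(k,x).$$ -/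

import Mathlib

namespace QMaxwell

noncomputable section

/-! ### `q`-numbers -/

/-- The `q`-number `[n]_q = (q^n - q^{-n}) / (q - q^{-1})` of an integer `n`, with its limit value
`n` at `q = 1`. -/
def qint (q : ℂ) (n : ℤ) : ℂ :=
  if q = 1 then (n : ℂ) else (q ^ n - q ^ (-n)) / (q - q⁻¹)

/-- The `q`-factorial `[n]_q! = [n]_q [n-1]_q ⋯ [1]_q`, with `[0]_q! = 1`. -/
def qfact (q : ℂ) (n : ℕ) : ℂ :=
  ∏ i ∈ Finset.range n, qint q ((i : ℤ) + 1)

/-- `1 / Γ_q(p)` at an integer `p`: it is `1 / [p-1]_q!` for `p ≥ 1` and `0` for `p ≤ 0`. -/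
def invGammaQ (q : ℂ) (p : ℤ) : ℂ :=
  if p ≤ 0 then 0 else (qfact q (p - 1).toNat)⁻¹

/-- `λ = q - q^{-1}`. -/
def lam (q : ℂ) : ℂ := q - q⁻¹

/-! ### Non-commuting momenta on the `q`-cone -/

/-- Labels of the four momentum components `k_v, k_-, k_+, k_{v̄}`. -/
inductive Mom
  | v
  | minus
  | plus
  | vbar

/-- The generator of the free algebra that belongs to a momentum component. -/
abbrev gen (κ : Mom) : FreeAlgebra ℂ Mom := FreeAlgebra.ι ℂ κ

/-- The commutation relations of `q`-Minkowski space, imposed on the momenta, together with the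
`q`-cone relation `k_- k_+ = q^{-1} k_v k_{v̄}`. -/
inductive ConeRel (q : ℂ) : FreeAlgebra ℂ Mom → FreeAlgebra ℂ Mom → Prop
  | plus_v : ConeRel q (gen .plus * gen .v) (q • (gen .v * gen .plus))
  | minus_v : ConeRel q (gen .minus * gen .v) (q⁻¹ • (gen .v * gen .minus))
  | plus_vbar : ConeRel q (gen .plus * gen .vbar) (q • (gen .vbar * gen .plus))
  | minus_vbar : ConeRel q (gen .minus * gen .vbar) (q⁻¹ • (gen .vbar * gen .minus))
  | plus_minus : ConeRel q (gen .plus * gen .minus - gen .minus * gen .plus)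
      (lam q • (gen .v * gen .vbar))
  | vbar_v : ConeRel q (gen .vbar * gen .v) (gen .v * gen .vbar)
  | cone : ConeRel q (gen .minus * gen .plus) (q⁻¹ • (gen .v * gen .vbar))

/-- The algebra of polynomials in the non-commuting momenta on the `q`-cone. -/
abbrev ConeAlg (q : ℂ) : Type := RingQuot (ConeRel q)

/-- Formal power series in the momenta on the `q`-cone. The relations are homogeneous, so a formal
power series is the sequence of its homogeneous parts; the coefficient of index `e` is the part
that is homogeneous of degree `e` in the momenta. -/
abbrev MomSeries (q : ℂ) : Type := PowerSeries (ConeAlg q)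

/-! ### Fields -/

/-- The variables of a field: the coordinates `v, x_-, x_+, v̄` and the auxiliary variables
`z, z̄` that carry the Lorentz indices. -/
inductive Var
  | v
  | minus
  | plus
  | vbar
  | z
  | zbar

/-- Formal power series with coefficients in the formal power series in the momenta. The exponent
`d : Var →₀ ℕ` stands for the normally ordered basis element
`v^{d v} x_-^{d minus} x_+^{d plus} v̄^{d vbar}`, times `z^{d z} z̄^{d zbar}`. Momenta commute with
coordinates and with `z, z̄`, but not with each other. The coordinates enter
through this basis only: the product of this ring is that of the coefficients and of `z, z̄`, and on
the coordinates it is used only to write down normally ordered monomials and to raise exponents. -/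
abbrev Field (q : ℂ) : Type := MvPowerSeries Var (MomSeries q)

/-- The momentum component `k_κ`, as a (constant) field. -/
def mom (q : ℂ) (κ : Mom) : Field q :=
  MvPowerSeries.C (PowerSeries.monomial 1 (RingQuot.mkAlgHom ℂ (ConeRel q) (gen κ)))

/-- The variable `κ`, as a field. -/
def var (q : ℂ) (κ : Var) : Field q := MvPowerSeries.X κ

/-! ### Operators on fields -/

/-- The operator that multiplies each monomial by a scalar which depends on the exponent. -/
def diagOp (q : ℂ) (c : (Var →₀ ℕ) → ℂ) : Module.End ℂ (Field q) where
  toFun F := fun d => c d • F d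
  map_add' F G := by
    funext d
    exact smul_add (c d) (F d) (G d)
  map_smul' a F := by
    funext d
    exact smul_comm (c d) a (F d)

/-- `T_κ^e = q^{e N_κ}` for `e : ℤ`. -/
def T (q : ℂ) (κ : Var) (e : ℤ) : Module.End ℂ (Field q) :=
  diagOp q fun d => q ^ (e * (d κ : ℤ))

/-- `[c - N_κ]_q`. -/
def qnum (q : ℂ) (c : ℤ) (κ : Var) : Module.End ℂ (Field q) :=
  diagOp q fun d => qint q (c - (d κ : ℤ))

/-- `M_κ`, which raises the exponent of the variable `κ` by one. -/
def M (q : ℂ) (κ : Var) : Module.End ℂ (Field q) :=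
  LinearMap.mulLeft ℂ (var q κ)

/-- The `q`-difference operator `D_κ = (1/λ) M_κ^{-1} (T_κ - T_κ^{-1}) = M_κ^{-1} [N_κ]_q`. It
sends the monomial with exponent `d` to `[d κ]_q` times the monomial whose exponent at `κ` is
lowered by one; at `q = 1` it is the partial derivative. -/
def D (q : ℂ) (κ : Var) : Module.End ℂ (Field q) where
  toFun F := fun d => qint q ((d κ : ℤ) + 1) • F (d + Finsupp.single κ 1)
  map_add' F G := by
    funext d
    exact smul_add _ (F (d + Finsupp.single κ 1)) (G (d + Finsupp.single κ 1))
  map_smul' a F := by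
    funext d
    exact smul_comm _ a (F (d + Finsupp.single κ 1))

/-- The operator `_qI^+_n` of the `q`-Maxwell hierarchy, in the basis `v^j x_-^n x_+^ℓ v̄^m`. -/
def Iplus (q : ℂ) (n : ℕ) : Module.End ℂ (Field q) :=
  (1 / 2 : ℂ) •
    (((q • D q .v + M q .zbar * D q .plus * (T q .minus (-1) * T q .v (-1)) * T q .vbar 1)
          * T q .minus 1 * qnum q ((n : ℤ) + 2) .z
        - q ^ (-(n : ℤ) - 2) •
          ((D q .minus * T q .minus 1 + q⁻¹ • (M q .zbar * D q .vbar)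
              - lam q • (M q .v * M q .zbar * D q .minus * D q .plus * T q .vbar 1))
            * T q .minus (-1) * D q .z))
      * T q .plus 1 * T q .v 1 * T q .z 1 * T q .zbar (-1))

/-- The operator `_qI^-_n` of the `q`-Maxwell hierarchy, in the basis `v^j x_-^n x_+^ℓ v̄^m`. -/
def Iminus (q : ℂ) (n : ℕ) : Module.End ℂ (Field q) :=
  (1 / 2 : ℂ) •
      ((D q .vbar + q • (M q .z * D q .plus * T q .vbar 1 * T q .minus 1 * T q .v (-1))
          - (q * lam q) • (M q .v * D q .minus * D q .plus * T q .vbar 1))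
        * T q .vbar 1 * qnum q ((n : ℤ) + 2) .zbar)
    - ((1 / 2 : ℂ) * q ^ (n + 3)) •
      ((D q .minus + q • (M q .z * D q .v * T q .minus 1))
        * D q .zbar * T q .minus 1 * T q .vbar 1)

/-! ### The `q`-plane wave -/

/-- The normalization `β^s` (`s` is an upper index). -/
def beta (q : ℂ) (s : ℕ) : ℂ :=
  (∑ p ∈ Finset.range (s + 1),
    q ^ (((s : ℤ) - p) * ((p : ℤ) - 1) + p) / (qfact q p * qfact q (s - p)))⁻¹

/-- The numerical coefficient of the term `(a, b, n)` of the component `f_s`. -/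
def waveCoeff (q : ℂ) (s a b n : ℕ) : ℂ :=
  (-1 : ℂ) ^ ((s : ℤ) - a - b)
    * q ^ ((n : ℤ) * (s - 2 * a - 2 * b + 2 * n) + a * ((s : ℤ) - a - 1)
        + b * (-(s : ℤ) + a + b + 1))
    * (invGammaQ q ((a : ℤ) - n + 1) * invGammaQ q ((b : ℤ) - n + 1)
        * invGammaQ q ((s : ℤ) - a - b + n + 1) * (qfact q n)⁻¹)

/-- The component `f_s` of the `q`-plane wave. A term with `a > s`, `b > s` or `n > s`, or with a
negative exponent, has a vanishing factor `1 / Γ_q`, so the sum runs over `a, b, n ≤ s` and the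
truncated subtraction in the exponents is harmless. -/
def wave (q : ℂ) (s : ℕ) : Field q :=
  beta q s • ∑ a ∈ Finset.range (s + 1), ∑ b ∈ Finset.range (s + 1), ∑ n ∈ Finset.range (s + 1),
    waveCoeff q s a b n •
      ((mom q .v ^ (s + n - a - b) * mom q .minus ^ (b - n) * mom q .plus ^ (a - n)
          * mom q .vbar ^ n)
        * (var q .v ^ n * var q .minus ^ (a - n) * var q .plus ^ (b - n)
          * var q .vbar ^ (s + n - a - b)))

/-! ### Formal infinite sums -/

/-- A family of fields has a formal sum if, for each exponent and each degree in the momenta, only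
finitely many members of the family contribute. -/
def FormallySummable {q : ℂ} {ι : Type} (u : ι → Field q) : Prop :=
  ∀ (d : Var →₀ ℕ) (e : ℕ),
    {i | PowerSeries.coeff e (MvPowerSeries.coeff d (u i)) ≠ 0}.Finite

/-- The coefficientwise sum of a formally summable family of fields. -/
def formalSum {q : ℂ} {ι : Type} (u : ι → Field q) : Field q :=
  fun d => PowerSeries.mk fun e => ∑ᶠ i, PowerSeries.coeff e (MvPowerSeries.coeff d (u i))

/-- The terms `f_s / [s]_q!` of the `q`-plane wave. -/
def expTerm (q : ℂ) (s : ℕ) : Field q := (1 / qfact q s) • wave q s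

/-- The `q`-plane wave `exp_q(k, x) = ∑_s f_s / [s]_q!`. -/
def expq (q : ℂ) : Field q := formalSum (expTerm q)

/-! ### The coefficient polynomials -/

/-- The constants `c^1_{ij}, c^2_i, c^3_{ij}` that enter a coefficient polynomial of given index
`m`; only `i ≤ m` and `j ≤ m - i` matter. -/
structure Consts where
  c1 : ℕ → ℕ → ℂ
  c2 : ℕ → ℂ
  c3 : ℕ → ℕ → ℂ

/-- The coefficient polynomial `F^{h+}_{ms}(k)` with constants `p`. -/
def plusPoly (q : ℂ) (m s : ℕ) (p : Consts) : Field q :=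
  let kv := mom q .v
  let km := mom q .minus
  let kp := mom q .plus
  let kb := mom q .vbar
  let z := var q .z
  ∑ i ∈ Finset.range (m + 1),
    ((∑ j ∈ Finset.range (m - i + 1),
        p.c1 i j • (kv ^ i * km ^ (m - i - j) * kb ^ j
          * (kv - q ^ (s + 6) • (z * km)) * (kv - q ^ (s + 3) • (z * km))))
      + p.c2 i • (kv ^ i * kb ^ (m - i)
          * (kv - q ^ (s + 6) • (z * km)) * (kp - q ^ (s + 3) • (z * kb)))
      + ∑ j ∈ Finset.range (m - i + 1),
        p.c3 i j • (kv ^ i * kp ^ (m - i - j) * kb ^ j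
          * (kp - q ^ (s + 6) • (z * kb)) * (kp - q ^ (s + 3) • (z * kb))))

/-- The coefficient polynomial `F^{h-}_{ms}(k)` with constants `r`; it depends on `s` only through
the constants. -/
def minusPoly (q : ℂ) (m : ℕ) (r : Consts) : Field q :=
  let kv := mom q .v
  let km := mom q .minus
  let kp := mom q .plus
  let kb := mom q .vbar
  let z := var q .zbar
  ∑ i ∈ Finset.range (m + 1),
    ((∑ j ∈ Finset.range (m - i + 1),
        r.c1 i j • (kv ^ i * km ^ (m - i - j) * kb ^ j
          * (kb - q⁻¹ • (z * km)) * (kb - z * km)))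
      + r.c2 i • (kv ^ i * kb ^ (m - i)
          * (kp - q⁻¹ • (z * kv)) * (kb - z * km))
      + ∑ j ∈ Finset.range (m - i + 1),
        r.c3 i j • (kv ^ i * kp ^ (m - i - j) * kb ^ j
          * (kp - q⁻¹ • (z * kv)) * (kp - z * kv)))

/-- The terms `(1 / [s]_q!) F^{h+}_{ms}(k) f_s`, indexed by the pairs `(m, s)`. -/
def plusTerm (q : ℂ) (p : ℕ → ℕ → Consts) (ms : ℕ × ℕ) : Field q :=
  (1 / qfact q ms.2) • (plusPoly q ms.1 ms.2 (p ms.1 ms.2) * wave q ms.2)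

/-- The terms `(1 / [s]_q!) F^{h-}_{ms}(k) f_s`, indexed by the pairs `(m, s)`. -/
def minusTerm (q : ℂ) (r : ℕ → ℕ → Consts) (ms : ℕ × ℕ) : Field q :=
  (1 / qfact q ms.2) • (minusPoly q ms.1 (r ms.1 ms.2) * wave q ms.2)

/-- `F^{h+} = ∑_{m,s} (1 / [s]_q!) F^{h+}_{ms}(k) f_s`. -/
def Fhplus (q : ℂ) (p : ℕ → ℕ → Consts) : Field q := formalSum (plusTerm q p)

/-- `F^{h-} = ∑_{m,s} (1 / [s]_q!) F^{h-}_{ms}(k) f_s`. -/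
def Fhminus (q : ℂ) (r : ℕ → ℕ → Consts) : Field q := formalSum (minusTerm q r)

end

end QMaxwell

namespace QMaxwell

noncomputable section

/-! ### Homogeneous parts in the momenta -/

/-! The operators `Iplus` and `Iminus` are built from `T`, `qnum`, `D`, `M`, and all of these
commute with left multiplication by a momentum and with the projection to a fixed momentum degree.
The term with index $(m,s)$ has momentum degree $m+2+s$, so in each degree the formal sums are
finite and may be treated term by term (`map_formalSum_eq_zero`). The monomials in front of the
linear factors can then be pulled out, which leaves two linear factors times $f_s$.

The coefficient of $v^nx_-^Ax_+^B\bar v^l$ in $f_s$ is a scalar times the word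
$k_v^lk_-^Bk_+^Ak_{\bar v}^n$. On the cone any two momenta commute up to a power of $q$. Hence
$\hat{\mathcal D}_v,\hat{\mathcal D}_-,\hat{\mathcal D}_+,\hat{\mathcal D}_{\bar v}$ act on $f_s$ as
left multiplication by $k_{\bar v},k_+,k_-,k_v$ on one common lower wave, up to signs and powers of
$q$ (`wave_succ_v` and its companions). The term with $\hat{\mathcal D}_-\hat{\mathcal D}_+$ reduces
to $k_v$ by `wave_succ_minus_succ_plus`. The normalization $\beta^s$ is a common factor, so its
value plays no role.

What remains are identities between words of three momenta (`Iplus_linear_mul_linear_mul_wave`,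
`Iminus_linear_mul_linear_mul_wave`). For factors $a_i-t_izb_i$ they follow from three exchange
relations; for example, $b_1a_2=q^{-1}a_1b_2$ gives
$q^{s+3}a_1b_2+q^{s+6}b_1a_2=q^{s+4}[2]_q\,a_1b_2$, which matches the factor $[2-N_z]_q$. The cone
relations supply the exchange relations for every pair of factors that occurs.

The factorization through $\exp_q(k,x)$ is the distributive law, checked in each momentum degree,
where all sums are finite. -/

/-- The part of a field that is homogeneous of degree `e` in the momenta. -/
def momProj (q : ℂ) (e : ℕ) : Module.End ℂ (Field q) where
  toFun F := fun d => PowerSeries.monomial e (PowerSeries.coeff e (F d))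
  map_add' F G := by
    funext d
    change PowerSeries.monomial e (PowerSeries.coeff e (F d + G d)) = _
    simp only [map_add]
    rfl
  map_smul' a F := by
    funext d
    change PowerSeries.monomial e (PowerSeries.coeff e (a • F d)) = a • _
    ext i
    simp [PowerSeries.coeff_monomial]

variable {q : ℂ}

theorem momProj_apply (e : ℕ) (F : Field q) (d : Var →₀ ℕ) :
    momProj q e F d = PowerSeries.monomial e (PowerSeries.coeff e (F d)) := rfl

theorem momProj_eq_zero_iff {e : ℕ} {F : Field q} :
    momProj q e F = 0 ↔ ∀ d, PowerSeries.coeff e (F d) = 0 := by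
  constructor
  · intro h d
    have h1 := congrArg (PowerSeries.coeff e) (congrFun h d)
    rw [momProj_apply, PowerSeries.coeff_monomial_same] at h1
    exact h1
  · intro h
    funext d
    rw [momProj_apply, h d, map_zero]
    rfl

theorem field_ext_momProj {F G : Field q} (h : ∀ e, momProj q e F = momProj q e G) : F = G := by
  funext d
  refine PowerSeries.ext fun e => ?_
  have h1 := congrArg (PowerSeries.coeff e) (congrFun (h e) d)
  simpa only [momProj_apply, PowerSeries.coeff_monomial_same] using h1

theorem momProj_mul (e : ℕ) (F G : Field q) :
    momProj q e (F * G) =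
      ∑ p ∈ Finset.HasAntidiagonal.antidiagonal e, momProj q p.1 F * momProj q p.2 G := by
  classical
  have key : ∀ f g : MomSeries q, PowerSeries.monomial e (PowerSeries.coeff e (f * g)) =
      ∑ p ∈ Finset.HasAntidiagonal.antidiagonal e, PowerSeries.monomial p.1 (PowerSeries.coeff p.1 f) *
        PowerSeries.monomial p.2 (PowerSeries.coeff p.2 g) := by
    intro f g
    rw [PowerSeries.coeff_mul, map_sum]
    refine Finset.sum_congr rfl fun p hp => ?_
    rw [PowerSeries.monomial_mul_monomial, Finset.HasAntidiagonal.mem_antidiagonal.1 hp]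
  refine MvPowerSeries.ext fun d => ?_
  change PowerSeries.monomial e (PowerSeries.coeff e (MvPowerSeries.coeff d (F * G))) = _
  rw [map_sum]
  simp only [MvPowerSeries.coeff_mul]
  rw [Finset.sum_comm]
  rw [map_sum, map_sum]
  exact Finset.sum_congr rfl fun x : (Var →₀ ℕ) × (Var →₀ ℕ) => fun _ => key (F x.1) (G x.2)

/-- `F` has no momentum components of degree other than `k`. -/
def MomHomogeneous (k : ℕ) (F : Field q) : Prop := ∀ e, e ≠ k → momProj q e F = 0

theorem MomHomogeneous.mul {a b : ℕ} {F G : Field q} (hF : MomHomogeneous a F)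
    (hG : MomHomogeneous b G) : MomHomogeneous (a + b) (F * G) := by
  intro e he
  rw [momProj_mul]
  refine Finset.sum_eq_zero fun p hp => ?_
  by_cases h1 : p.1 = a
  · have h2 : p.2 ≠ b := fun h2 => he (by rw [← Finset.HasAntidiagonal.mem_antidiagonal.1 hp, h1, h2])
    rw [hG _ h2, mul_zero]
  · rw [hF _ h1, zero_mul]

theorem MomHomogeneous.add {a : ℕ} {F G : Field q} (hF : MomHomogeneous a F)
    (hG : MomHomogeneous a G) : MomHomogeneous a (F + G) := fun e he => by
  rw [map_add, hF e he, hG e he, add_zero]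

theorem MomHomogeneous.sub {a : ℕ} {F G : Field q} (hF : MomHomogeneous a F)
    (hG : MomHomogeneous a G) : MomHomogeneous a (F - G) := fun e he => by
  rw [map_sub, hF e he, hG e he, sub_zero]

theorem MomHomogeneous.smul {a : ℕ} {F : Field q} (c : ℂ) (hF : MomHomogeneous a F) :
    MomHomogeneous a (c • F) := fun e he => by
  rw [map_smul, hF e he, smul_zero]

theorem MomHomogeneous.sum {ι : Type} {a : ℕ} {s : Finset ι} {F : ι → Field q}
    (hF : ∀ i ∈ s, MomHomogeneous a (F i)) : MomHomogeneous a (∑ i ∈ s, F i) := fun e he => by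
  rw [map_sum]
  exact Finset.sum_eq_zero fun i hi => hF i hi e he

theorem momHomogeneous_zero (a : ℕ) : MomHomogeneous a (0 : Field q) := fun _ _ => map_zero _

theorem momHomogeneous_var (κ : Var) : MomHomogeneous 0 (var q κ) := by
  classical
  intro e he
  refine momProj_eq_zero_iff.2 fun d => ?_
  change PowerSeries.coeff e (MvPowerSeries.coeff d (MvPowerSeries.X κ : Field q)) = 0
  rw [MvPowerSeries.coeff_X]
  split_ifs
  · rw [PowerSeries.coeff_one, if_neg he]
  · exact map_zero _

theorem momHomogeneous_one : MomHomogeneous 0 (1 : Field q) := by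
  classical
  intro e he
  refine momProj_eq_zero_iff.2 fun d => ?_
  change PowerSeries.coeff e (MvPowerSeries.coeff d (1 : Field q)) = 0
  rw [MvPowerSeries.coeff_one]
  split_ifs
  · rw [PowerSeries.coeff_one, if_neg he]
  · exact map_zero _

theorem momHomogeneous_mom (κ : Mom) : MomHomogeneous 1 (mom q κ) := by
  classical
  intro e he
  refine momProj_eq_zero_iff.2 fun d => ?_
  change PowerSeries.coeff e (MvPowerSeries.coeff d (mom q κ)) = 0
  rw [mom, MvPowerSeries.coeff_C]
  split_ifs
  · rw [PowerSeries.coeff_monomial, if_neg he]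
  · exact map_zero _

theorem MomHomogeneous.pow {a : ℕ} {F : Field q} (hF : MomHomogeneous a F) (n : ℕ) :
    MomHomogeneous (n * a) (F ^ n) := by
  induction n with
  | zero => simpa using momHomogeneous_one
  | succ n ih => simpa only [pow_succ, Nat.succ_mul] using ih.mul hF

theorem MomHomogeneous.congr {a b : ℕ} {F : Field q} (hF : MomHomogeneous a F) (h : a = b) :
    MomHomogeneous b F := h ▸ hF

/-! ### Formal sums -/

theorem formallySummable_of_momProj {ι : Type} {u : ι → Field q}
    (h : ∀ e, ∃ S : Finset ι, ∀ i ∉ S, momProj q e (u i) = 0) : FormallySummable u := by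
  intro d e
  obtain ⟨S, hS⟩ := h e
  refine S.finite_toSet.subset fun i hi => ?_
  by_contra hiS
  exact hi (momProj_eq_zero_iff.1 (hS i hiS) d)

theorem momProj_formalSum {ι : Type} {u : ι → Field q} {e : ℕ} (S : Finset ι)
    (hS : ∀ i ∉ S, momProj q e (u i) = 0) :
    momProj q e (formalSum u) = ∑ i ∈ S, momProj q e (u i) := by
  refine MvPowerSeries.ext fun d => ?_
  rw [map_sum]
  change PowerSeries.monomial e (PowerSeries.coeff e (PowerSeries.mk fun e =>
    ∑ᶠ i, PowerSeries.coeff e (MvPowerSeries.coeff d (u i)))) =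
    ∑ i ∈ S, PowerSeries.monomial e (PowerSeries.coeff e (MvPowerSeries.coeff d (u i)))
  -- The support lies in `S`, so `∑ᶠ` is a genuine finite sum and not its default value `0`.
  rw [PowerSeries.coeff_mk, finsum_eq_sum_of_support_subset, map_sum]
  intro i hi
  by_contra hiS
  exact hi (momProj_eq_zero_iff.1 (hS i hiS) d)

/-- An operator that respects the degree in the momenta and annihilates each term of a formally
summable family annihilates its sum. -/
theorem map_formalSum_eq_zero {ι : Type} {u : ι → Field q} {L : Module.End ℂ (Field q)}
    (hL : ∀ e, Commute (momProj q e) L)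
    (h : ∀ e, ∃ S : Finset ι, ∀ i ∉ S, momProj q e (u i) = 0) (hu : ∀ i, L (u i) = 0) :
    L (formalSum u) = 0 := by
  refine field_ext_momProj fun e => ?_
  obtain ⟨S, hS⟩ := h e
  have hc : ∀ F, momProj q e (L F) = L (momProj q e F) := fun F => LinearMap.congr_fun (hL e) F
  rw [hc, momProj_formalSum S hS, map_sum, map_zero]
  exact Finset.sum_eq_zero fun i _ => by rw [← hc, hu, map_zero]

/-! ### Operators that commute with all `T`, `D` and `M` -/

theorem commute_momProj_diagOp (e : ℕ) (c : (Var →₀ ℕ) → ℂ) :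
    Commute (momProj q e) (diagOp q c) := by
  refine LinearMap.ext fun F => funext fun d => ?_
  change PowerSeries.monomial e (PowerSeries.coeff e (c d • F d)) =
    c d • PowerSeries.monomial e (PowerSeries.coeff e (F d))
  ext i
  simp [PowerSeries.coeff_monomial]

theorem commute_momProj_D (e : ℕ) (κ : Var) : Commute (momProj q e) (D q κ) := by
  refine LinearMap.ext fun F => funext fun d => ?_
  change PowerSeries.monomial e (PowerSeries.coeff e (qint q ((d κ : ℤ) + 1) • F _)) =
    qint q ((d κ : ℤ) + 1) • PowerSeries.monomial e (PowerSeries.coeff e (F _))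
  ext i
  simp [PowerSeries.coeff_monomial]

theorem momProj_zero_var (κ : Var) : momProj q 0 (var q κ) = var q κ := by
  classical
  refine MvPowerSeries.ext fun d => ?_
  change PowerSeries.monomial 0 (PowerSeries.coeff 0
    (MvPowerSeries.coeff d (MvPowerSeries.X κ : Field q))) =
    MvPowerSeries.coeff d (MvPowerSeries.X κ : Field q)
  rw [MvPowerSeries.coeff_X]
  split_ifs <;> simp

theorem commute_momProj_M (e : ℕ) (κ : Var) : Commute (momProj q e) (M q κ) := by
  refine LinearMap.ext fun F => ?_
  change momProj q e (var q κ * F) = var q κ * momProj q e F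
  rw [momProj_mul, Finset.sum_eq_single (0, e), momProj_zero_var]
  · rintro ⟨a, b⟩ hp hne
    have ha : a ≠ 0 := by
      rintro rfl
      rw [Finset.HasAntidiagonal.mem_antidiagonal, zero_add] at hp
      exact hne (by rw [← hp])
    rw [momHomogeneous_var κ a ha, zero_mul]
  · intro h
    exact absurd (Finset.HasAntidiagonal.mem_antidiagonal.2 (zero_add e)) h

theorem commute_end_sub {L A B : Module.End ℂ (Field q)} (hA : Commute L A) (hB : Commute L B) :
    Commute L (A - B) := by
  refine LinearMap.ext fun F => ?_
  change L (A F - B F) = A (L F) - B (L F)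
  have h₁ : L (A F) = A (L F) := LinearMap.congr_fun hA F
  have h₂ : L (B F) = B (L F) := LinearMap.congr_fun hB F
  rw [map_sub, h₁, h₂]

theorem commute_end_add {L A B : Module.End ℂ (Field q)} (hA : Commute L A) (hB : Commute L B) :
    Commute L (A + B) := hA.add_right hB

theorem commute_end_smul {L A : Module.End ℂ (Field q)} (c : ℂ) (hA : Commute L A) :
    Commute L (c • A) := hA.smul_right c

/-- `L` is kept abstract because this is needed both for `momProj q e` and for left multiplication
by a momentum. -/
theorem commute_Iplus {L : Module.End ℂ (Field q)} (hdiag : ∀ c, Commute L (diagOp q c))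
    (hD : ∀ κ, Commute L (D q κ)) (hM : ∀ κ, Commute L (M q κ)) (n : ℕ) :
    Commute L (Iplus q n) := by
  have hT : ∀ κ e, Commute L (T q κ e) := fun κ e => hdiag _
  have hN : ∀ c κ, Commute L (qnum q c κ) := fun κ e => hdiag _
  exact commute_end_smul _ <| Commute.mul_right (Commute.mul_right (Commute.mul_right
    (Commute.mul_right (commute_end_sub
      (Commute.mul_right (Commute.mul_right (commute_end_add (commute_end_smul _ (hD _))
        (Commute.mul_right (Commute.mul_right (Commute.mul_right (hM _) (hD _))
          (Commute.mul_right (hT _ _) (hT _ _))) (hT _ _))) (hT _ _)) (hN _ _))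
      (commute_end_smul _ (Commute.mul_right (Commute.mul_right (commute_end_sub (commute_end_add
        (Commute.mul_right (hD _) (hT _ _))
        (commute_end_smul _ (Commute.mul_right (hM _) (hD _))))
        (commute_end_smul _ (Commute.mul_right (Commute.mul_right (Commute.mul_right
          (Commute.mul_right (hM _) (hM _)) (hD _)) (hD _)) (hT _ _)))) (hT _ _)) (hD _))))
    (hT _ _)) (hT _ _)) (hT _ _)) (hT _ _)

theorem commute_Iminus {L : Module.End ℂ (Field q)} (hdiag : ∀ c, Commute L (diagOp q c))
    (hD : ∀ κ, Commute L (D q κ)) (hM : ∀ κ, Commute L (M q κ)) (n : ℕ) :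
    Commute L (Iminus q n) := by
  have hT : ∀ κ e, Commute L (T q κ e) := fun κ e => hdiag _
  have hN : ∀ c κ, Commute L (qnum q c κ) := fun κ e => hdiag _
  exact commute_end_sub
    (commute_end_smul _ (Commute.mul_right (Commute.mul_right (commute_end_sub (commute_end_add
      (hD _) (commute_end_smul _ (Commute.mul_right (Commute.mul_right (Commute.mul_right
        (Commute.mul_right (hM _) (hD _)) (hT _ _)) (hT _ _)) (hT _ _))))
      (commute_end_smul _ (Commute.mul_right (Commute.mul_right (Commute.mul_right
        (hM _) (hD _)) (hD _)) (hT _ _)))) (hT _ _)) (hN _ _)))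
    (commute_end_smul _ (Commute.mul_right (Commute.mul_right (Commute.mul_right (commute_end_add
      (hD _) (commute_end_smul _ (Commute.mul_right (Commute.mul_right (hM _) (hD _)) (hT _ _))))
      (hD _)) (hT _ _)) (hT _ _)))

theorem C_mul_apply (x : MomSeries q) (F : Field q) (d : Var →₀ ℕ) :
    (MvPowerSeries.C x * F : Field q) d = x * F d :=
  MvPowerSeries.coeff_C_mul d F x

theorem commute_mulLeft_mom_diagOp (κ : Mom) (c : (Var →₀ ℕ) → ℂ) :
    Commute (LinearMap.mulLeft ℂ (mom q κ)) (diagOp q c) := by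
  refine LinearMap.ext fun F => funext fun d => ?_
  change (MvPowerSeries.C _ * diagOp q c F : Field q) d = c d • (MvPowerSeries.C _ * F : Field q) d
  rw [C_mul_apply, C_mul_apply]
  exact mul_smul_comm _ _ _

theorem commute_mulLeft_mom_D (κ : Mom) (κ' : Var) :
    Commute (LinearMap.mulLeft ℂ (mom q κ)) (D q κ') := by
  refine LinearMap.ext fun F => funext fun d => ?_
  change (MvPowerSeries.C _ * D q κ' F : Field q) d =
    qint q ((d κ' : ℤ) + 1) • (MvPowerSeries.C _ * F : Field q) _
  rw [C_mul_apply, C_mul_apply]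
  exact mul_smul_comm _ _ _

theorem commute_mom_var (κ : Mom) (κ' : Var) : Commute (mom q κ) (var q κ') :=
  MvPowerSeries.commute_X _ _

theorem commute_mulLeft_mom_M (κ : Mom) (κ' : Var) :
    Commute (LinearMap.mulLeft ℂ (mom q κ)) (M q κ') := by
  refine LinearMap.ext fun F => ?_
  change mom q κ * (var q κ' * F) = var q κ' * (mom q κ * F)
  rw [← mul_assoc, ← mul_assoc, (commute_mom_var κ κ').eq]

/-- `L` annihilates `a * F` for each momentum component `a` if it annihilates `F`. -/
theorem map_mom_mul_eq_zero {L : Module.End ℂ (Field q)}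
    (hL : ∀ κ, Commute (LinearMap.mulLeft ℂ (mom q κ)) L) {F : Field q} (hF : L F = 0) (κ : Mom) :
    L (mom q κ * F) = 0 := by
  have h := LinearMap.congr_fun (hL κ) F
  change mom q κ * L F = L (mom q κ * F) at h
  rw [← h, hF, mul_zero]

theorem map_mom_pow_mul_eq_zero {L : Module.End ℂ (Field q)}
    (hL : ∀ κ, Commute (LinearMap.mulLeft ℂ (mom q κ)) L) {F : Field q} (hF : L F = 0) (κ : Mom)
    (n : ℕ) : L (mom q κ ^ n * F) = 0 := by
  induction n with
  | zero => simpa using hF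
  | succ n ih =>
    rw [pow_succ', mul_assoc]
    exact map_mom_mul_eq_zero hL ih κ

/-! ### The momenta as power series -/

/-- The momentum component `k_κ`, as a formal power series in the momenta. -/
def kmom (q : ℂ) (κ : Mom) : MomSeries q :=
  PowerSeries.monomial 1 (RingQuot.mkAlgHom ℂ (ConeRel q) (gen κ))

theorem mom_eq_C (κ : Mom) : mom q κ = MvPowerSeries.C (kmom q κ) := rfl

theorem monomial_smul (n : ℕ) (c : ℂ) (x : ConeAlg q) :
    PowerSeries.monomial n (c • x) = c • (PowerSeries.monomial n x : MomSeries q) := by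
  ext i
  simp [PowerSeries.coeff_monomial]

theorem kmom_mul (κ κ' : Mom) : kmom q κ * kmom q κ' =
    PowerSeries.monomial 2 (RingQuot.mkAlgHom ℂ (ConeRel q) (gen κ * gen κ')) := by
  rw [kmom, kmom, PowerSeries.monomial_mul_monomial, map_mul (RingQuot.mkAlgHom ℂ (ConeRel q))]

theorem kmom_mul_of_rel {κ κ' μ μ' : Mom} {c : ℂ}
    (h : ConeRel q (gen κ * gen κ') (c • (gen μ * gen μ'))) :
    kmom q κ * kmom q κ' = c • (kmom q μ * kmom q μ') := by
  rw [kmom_mul, kmom_mul, RingQuot.mkAlgHom_rel ℂ h, map_smul, monomial_smul]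

theorem plus_mul_v : kmom q .plus * kmom q .v = q • (kmom q .v * kmom q .plus) :=
  kmom_mul_of_rel .plus_v

theorem minus_mul_v : kmom q .minus * kmom q .v = q⁻¹ • (kmom q .v * kmom q .minus) :=
  kmom_mul_of_rel .minus_v

theorem plus_mul_vbar : kmom q .plus * kmom q .vbar = q • (kmom q .vbar * kmom q .plus) :=
  kmom_mul_of_rel .plus_vbar

theorem minus_mul_vbar : kmom q .minus * kmom q .vbar = q⁻¹ • (kmom q .vbar * kmom q .minus) :=
  kmom_mul_of_rel .minus_vbar

theorem minus_mul_plus : kmom q .minus * kmom q .plus = q⁻¹ • (kmom q .v * kmom q .vbar) :=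
  kmom_mul_of_rel .cone

theorem vbar_mul_v : kmom q .vbar * kmom q .v = kmom q .v * kmom q .vbar := by
  rw [kmom_mul, kmom_mul, RingQuot.mkAlgHom_rel ℂ (.vbar_v : ConeRel q _ _)]

/-- The commutator adds $\lambda=q-q^{-1}$ to the $q^{-1}$ of the cone relation. Thus $k_+k_-$ and
$k_-k_+$ are both multiples of $k_vk_{\bar v}$, and all pairs of momenta commute up to a power of
$q$. -/
theorem plus_mul_minus : kmom q .plus * kmom q .minus = q • (kmom q .v * kmom q .vbar) := by
  have h : kmom q .plus * kmom q .minus - kmom q .minus * kmom q .plus =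
      lam q • (kmom q .v * kmom q .vbar) := by
    rw [kmom_mul, kmom_mul, kmom_mul, ← map_sub, ← map_sub,
      RingQuot.mkAlgHom_rel ℂ (.plus_minus : ConeRel q _ _), map_smul, monomial_smul]
  rw [sub_eq_iff_eq_add.1 h, minus_mul_plus, ← add_smul, lam, sub_add_cancel]

theorem minus_mul_plus' (hq : q ≠ 0) :
    kmom q .minus * kmom q .plus = (q⁻¹ ^ 2) • (kmom q .plus * kmom q .minus) := by
  rw [minus_mul_plus, plus_mul_minus, smul_smul]
  congr 1
  field_simp

theorem v_mul_plus (hq : q ≠ 0) :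
    kmom q .v * kmom q .plus = q⁻¹ • (kmom q .plus * kmom q .v) := by
  rw [plus_mul_v, smul_smul, inv_mul_cancel₀ hq, one_smul]

theorem v_mul_minus (hq : q ≠ 0) :
    kmom q .v * kmom q .minus = q • (kmom q .minus * kmom q .v) := by
  rw [minus_mul_v, smul_smul, mul_inv_cancel₀ hq, one_smul]

/-- The tail `x` lets the exchange take place at the front of a right-associated word. -/
theorem pow_mul_of_qcommute {R : Type*} [Ring R] [Algebra ℂ R] {a b : R} {c : ℂ}
    (h : a * b = c • (b * a)) (n : ℕ) (x : R) : a ^ n * (b * x) = c ^ n • (b * (a ^ n * x)) := by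
  induction n generalizing x with
  | zero => simp
  | succ n ih =>
    rw [pow_succ, mul_assoc, ← mul_assoc a b x, h, smul_mul_assoc, mul_smul_comm, mul_assoc, ih,
      smul_smul, mul_assoc, pow_succ']

/-- The word `k_v^l k_-^B k_+^A k_{v̄}^n` that multiplies `v^n x_-^A x_+^B v̄^l` in the
`q`-plane wave. -/
def waveWord (q : ℂ) (n A B l : ℕ) : MomSeries q :=
  kmom q .v ^ l * (kmom q .minus ^ B * (kmom q .plus ^ A * kmom q .vbar ^ n))

/-- Raising the exponent of a coordinate inserts one more copy of the corresponding momentum into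
the word. Here and in the next three lemmas this letter is carried to the far left, each exchange
costing a power of $q$. -/
theorem waveWord_succ_v (n A B l : ℕ) : waveWord q (n + 1) A B l =
    (q ^ A * q⁻¹ ^ B) • (kmom q .vbar * waveWord q n A B l) := by
  rw [waveWord, pow_succ', pow_mul_of_qcommute plus_mul_vbar, mul_smul_comm,
    pow_mul_of_qcommute minus_mul_vbar, mul_smul_comm, mul_smul_comm,
    pow_mul_of_qcommute (c := 1) (by rw [one_smul, vbar_mul_v]), one_pow, one_smul, smul_smul]
  rfl

theorem waveWord_succ_minus (hq : q ≠ 0) (n A B l : ℕ) : waveWord q n (A + 1) B l =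
    ((q⁻¹ ^ 2) ^ B * q⁻¹ ^ l) • (kmom q .plus * waveWord q n A B l) := by
  rw [waveWord, pow_succ', mul_assoc, pow_mul_of_qcommute (minus_mul_plus' hq), mul_smul_comm,
    pow_mul_of_qcommute (v_mul_plus hq), smul_smul]
  rfl

theorem waveWord_succ_plus (hq : q ≠ 0) (n A B l : ℕ) : waveWord q n A (B + 1) l =
    q ^ l • (kmom q .minus * waveWord q n A B l) := by
  rw [waveWord, pow_succ', mul_assoc, pow_mul_of_qcommute (v_mul_minus hq)]
  rfl

theorem waveWord_succ_vbar (n A B l : ℕ) : waveWord q n A B (l + 1) =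
    kmom q .v * waveWord q n A B l := by
  rw [waveWord, pow_succ', mul_assoc]
  rfl

/-! ### Exponents -/

/-- The exponent of `v^n x_-^A x_+^B v̄^l z^c z̄^e`. -/
def expo (n A B l c e : ℕ) : Var →₀ ℕ :=
  Finsupp.single .v n + Finsupp.single .minus A + Finsupp.single .plus B + Finsupp.single .vbar l
    + Finsupp.single .z c + Finsupp.single .zbar e

section expo

variable (n A B l c e : ℕ)

@[simp] theorem expo_v : expo n A B l c e .v = n := by
  simp [expo]

@[simp] theorem expo_minus : expo n A B l c e .minus = A := by
  simp [expo]

@[simp] theorem expo_plus : expo n A B l c e .plus = B := by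
  simp [expo]

@[simp] theorem expo_vbar : expo n A B l c e .vbar = l := by
  simp [expo]

@[simp] theorem expo_z : expo n A B l c e .z = c := by
  simp [expo]

@[simp] theorem expo_zbar : expo n A B l c e .zbar = e := by
  simp [expo]

theorem expo_surj (d : Var →₀ ℕ) :
    d = expo (d .v) (d .minus) (d .plus) (d .vbar) (d .z) (d .zbar) := by
  ext κ
  cases κ <;> simp

theorem expo_inj {n A B l c e n' A' B' l' c' e' : ℕ} :
    expo n A B l c e = expo n' A' B' l' c' e' ↔
      n = n' ∧ A = A' ∧ B = B' ∧ l = l' ∧ c = c' ∧ e = e' := by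
  constructor
  · intro h
    have h1 := fun κ => DFunLike.congr_fun h κ
    exact ⟨by simpa using h1 .v, by simpa using h1 .minus, by simpa using h1 .plus,
      by simpa using h1 .vbar, by simpa using h1 .z, by simpa using h1 .zbar⟩
  · rintro ⟨rfl, rfl, rfl, rfl, rfl, rfl⟩
    rfl

theorem field_ext_expo {F G : Field q}
    (h : ∀ n A B l c e, F (expo n A B l c e) = G (expo n A B l c e)) : F = G := by
  funext d
  rw [expo_surj d]
  exact h _ _ _ _ _ _

/-! ### Operators in coordinates -/

variable (F : Field q)

theorem D_v_apply : D q .v F (expo n A B l c e) =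
    qint q ((n : ℤ) + 1) • F (expo (n + 1) A B l c e) := by
  change qint q (((expo n A B l c e .v : ℕ) : ℤ) + 1) • F (_ + _) = _
  rw [expo_v]
  congr 2
  simp only [expo, Finsupp.single_add]; abel

theorem D_minus_apply : D q .minus F (expo n A B l c e) =
    qint q ((A : ℤ) + 1) • F (expo n (A + 1) B l c e) := by
  change qint q (((expo n A B l c e .minus : ℕ) : ℤ) + 1) • F (_ + _) = _
  rw [expo_minus]
  congr 2
  simp only [expo, Finsupp.single_add]; abel

theorem D_plus_apply : D q .plus F (expo n A B l c e) =
    qint q ((B : ℤ) + 1) • F (expo n A (B + 1) l c e) := by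
  change qint q (((expo n A B l c e .plus : ℕ) : ℤ) + 1) • F (_ + _) = _
  rw [expo_plus]
  congr 2
  simp only [expo, Finsupp.single_add]; abel

theorem D_vbar_apply : D q .vbar F (expo n A B l c e) =
    qint q ((l : ℤ) + 1) • F (expo n A B (l + 1) c e) := by
  change qint q (((expo n A B l c e .vbar : ℕ) : ℤ) + 1) • F (_ + _) = _
  rw [expo_vbar]
  congr 2
  simp only [expo, Finsupp.single_add]; abel

theorem D_z_apply : D q .z F (expo n A B l c e) =
    qint q ((c : ℤ) + 1) • F (expo n A B l (c + 1) e) := by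
  change qint q (((expo n A B l c e .z : ℕ) : ℤ) + 1) • F (_ + _) = _
  rw [expo_z]
  congr 2
  simp only [expo, Finsupp.single_add]; abel

theorem D_zbar_apply : D q .zbar F (expo n A B l c e) =
    qint q ((e : ℤ) + 1) • F (expo n A B l c (e + 1)) := by
  change qint q (((expo n A B l c e .zbar : ℕ) : ℤ) + 1) • F (_ + _) = _
  rw [expo_zbar]
  congr 2
  simp only [expo, Finsupp.single_add]; abel

theorem var_mul_apply_of_eq_zero {κ : Var} {d : Var →₀ ℕ} (h : d κ = 0) :
    (var q κ * F : Field q) d = 0 := by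
  change MvPowerSeries.coeff d (MvPowerSeries.monomial (Finsupp.single κ 1) 1 * F) = 0
  rw [MvPowerSeries.coeff_monomial_mul, if_neg]
  intro h'
  simpa [h] using h' κ

theorem var_mul_apply_add (κ : Var) (d : Var →₀ ℕ) :
    (var q κ * F : Field q) (Finsupp.single κ 1 + d) = F d := by
  change MvPowerSeries.coeff _ (MvPowerSeries.monomial (Finsupp.single κ 1) 1 * F) = F d
  rw [MvPowerSeries.coeff_add_monomial_mul, one_mul]
  rfl

theorem v_mul_apply : (var q .v * F : Field q) (expo n A B l c e) =
    if n = 0 then 0 else F (expo (n - 1) A B l c e) := by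
  split_ifs with h
  · exact var_mul_apply_of_eq_zero F (by rw [expo_v, h])
  · obtain ⟨m, rfl⟩ := Nat.exists_eq_succ_of_ne_zero h
    have hs : expo (m + 1) A B l c e = Finsupp.single .v 1 + expo m A B l c e := by
      simp only [expo, Finsupp.single_add]
      abel
    rw [Nat.succ_sub_one, ← var_mul_apply_add F .v, ← hs]

theorem z_mul_apply : (var q .z * F : Field q) (expo n A B l c e) =
    if c = 0 then 0 else F (expo n A B l (c - 1) e) := by
  split_ifs with h
  · exact var_mul_apply_of_eq_zero F (by rw [expo_z, h])
  · obtain ⟨m, rfl⟩ := Nat.exists_eq_succ_of_ne_zero h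
    have hs : expo n A B l (m + 1) e = Finsupp.single .z 1 + expo n A B l m e := by
      simp only [expo, Finsupp.single_add]
      abel
    rw [Nat.succ_sub_one, ← var_mul_apply_add F .z, ← hs]

theorem zbar_mul_apply : (var q .zbar * F : Field q) (expo n A B l c e) =
    if e = 0 then 0 else F (expo n A B l c (e - 1)) := by
  split_ifs with h
  · exact var_mul_apply_of_eq_zero F (by rw [expo_zbar, h])
  · obtain ⟨m, rfl⟩ := Nat.exists_eq_succ_of_ne_zero h
    have hs : expo n A B l c (m + 1) = Finsupp.single .zbar 1 + expo n A B l c m := by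
      simp only [expo, Finsupp.single_add]
      abel
    rw [Nat.succ_sub_one, ← var_mul_apply_add F .zbar, ← hs]

end expo

/-! ### `q`-numbers -/

theorem qint_ne_zero (hq : q ≠ 0) (hroot : ∀ N : ℕ, 0 < N → q ^ N = 1 → q = 1) (n : ℕ) :
    qint q ((n : ℤ) + 1) ≠ 0 := by
  unfold qint
  split_ifs with h
  · exact_mod_cast Nat.succ_ne_zero n
  · have hne : ∀ N : ℕ, q ^ (N + 1) - (q ^ (N + 1))⁻¹ ≠ 0 := by
      intro N h1
      have h2 : q ^ (N + 1) ≠ 0 := pow_ne_zero _ hq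
      -- A vanishing $q$-number would make $q^2$ a root of unity, hence $q=1$, which this branch
      -- excludes.
      have h3 : q ^ (2 * (N + 1)) = 1 := by
        field_simp at h1
        rw [pow_mul']
        linear_combination h1
      exact h (hroot _ (by omega) h3)
    refine div_ne_zero ?_ ?_
    · have := hne n
      rw [zpow_neg]
      exact_mod_cast this
    · simpa using hne 0

theorem lam_mul_qint (n : ℤ) (hroot : ∀ N : ℕ, 0 < N → q ^ N = 1 → q = 1) (hq : q ≠ 0) :
    lam q * qint q n = q ^ n - q ^ (-n) := by
  unfold qint lam
  split_ifs with h
  · simp [h]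
  · refine mul_div_cancel₀ _ fun h1 => h (hroot 2 two_pos ?_)
    field_simp at h1
    linear_combination h1

theorem qint_zero : qint q 0 = 0 := by simp [qint]

theorem qint_one (hroot : ∀ N : ℕ, 0 < N → q ^ N = 1 → q = 1) (hq : q ≠ 0) : qint q 1 = 1 := by
  unfold qint
  split_ifs with h
  · simp
  · rw [zpow_neg, zpow_one]
    refine div_self fun h1 => h (hroot 2 two_pos ?_)
    field_simp at h1
    linear_combination h1

theorem qint_two (hroot : ∀ N : ℕ, 0 < N → q ^ N = 1 → q = 1) (hq : q ≠ 0) :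
    qint q 2 = q + q⁻¹ := by
  unfold qint
  split_ifs with h
  · simp [h]; norm_num
  · rw [div_eq_iff]
    · rw [zpow_neg]
      norm_cast
      field_simp
      ring
    · intro h1
      refine h (hroot 2 two_pos ?_)
      field_simp at h1
      linear_combination h1

theorem qfact_succ (n : ℕ) : qfact q (n + 1) = qfact q n * qint q ((n : ℤ) + 1) := by
  rw [qfact, Finset.prod_range_succ]
  rfl

theorem invGammaQ_add_one (n : ℕ) : invGammaQ q ((n : ℤ) + 1) = (qfact q n)⁻¹ := by
  rw [invGammaQ, if_neg (by omega)]
  simp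

/-! ### The coefficients of the `q`-plane wave -/

theorem waveCoeff_eq_zero {s a b n : ℕ} (h : a < n ∨ b < n ∨ s + n < a + b) :
    waveCoeff q s a b n = 0 := by
  have h0 : ∀ p : ℤ, p ≤ 0 → invGammaQ q p = 0 := fun p hp => if_pos hp
  rcases h with h | h | h
  · rw [waveCoeff, h0 ((a : ℤ) - n + 1) (by omega)]
    ring
  · rw [waveCoeff, h0 ((b : ℤ) - n + 1) (by omega)]
    ring
  · rw [waveCoeff, h0 ((s : ℤ) - a - b + n + 1) (by omega)]
    ring

theorem var_pow (κ : Var) (n : ℕ) :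
    var q κ ^ n = MvPowerSeries.monomial (Finsupp.single κ n) 1 := by
  rw [var, MvPowerSeries.X_pow_eq]

theorem waveTerm_eq (a b n l : ℕ) :
    (mom q .v ^ l * mom q .minus ^ b * mom q .plus ^ a * mom q .vbar ^ n)
        * (var q .v ^ n * var q .minus ^ a * var q .plus ^ b * var q .vbar ^ l) =
      MvPowerSeries.C (waveWord q n a b l) * MvPowerSeries.monomial (expo n a b l 0 0) 1 := by
  simp only [mom_eq_C, var_pow, waveWord, ← map_pow, ← map_mul,
    MvPowerSeries.monomial_mul_monomial, mul_one, expo, Finsupp.single_zero, add_zero, mul_assoc]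

/-- The nested conditionals have the shape in which the three sums of the wave collapse one after
another by `Finset.sum_ite_eq'`. -/
theorem smul_waveTerm_apply (s a b N n A B l c e : ℕ) :
    (waveCoeff q s a b N •
      (MvPowerSeries.C (waveWord q N (a - N) (b - N) (s + N - a - b)) *
        MvPowerSeries.monomial (expo N (a - N) (b - N) (s + N - a - b) 0 0) 1) : Field q)
        (expo n A B l c e) =
      if N = n then if b = B + n then if a = A + n then
        if c = 0 ∧ e = 0 ∧ n + A + B + l = s then
          waveCoeff q s (A + n) (B + n) n • waveWord q n A B l else 0
      else 0 else 0 else 0 := by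
  classical
  -- Where a truncated subtraction is not the true one, the factor $1/\Gamma_q$ makes the
  -- coefficient zero.
  by_cases h0 : a < N ∨ b < N ∨ s + N < a + b
  · rw [waveCoeff_eq_zero h0, zero_smul]
    split_ifs
    · omega
    all_goals rfl
  · change waveCoeff q s a b N • (MvPowerSeries.C _ * MvPowerSeries.monomial _ 1 : Field q) _ = _
    rw [C_mul_apply]
    change waveCoeff q s a b N • (_ * MvPowerSeries.coeff (expo n A B l c e)
      (MvPowerSeries.monomial _ 1)) = _
    rw [MvPowerSeries.coeff_monomial]
    push Not at h0
    split_ifs with h1 h2 h3 h4 h5 h6 h7 h8 h9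
    all_goals try rw [expo_inj] at h1
    · obtain ⟨rfl, rfl, rfl, rfl, -, -⟩ := h1
      rw [mul_one, ← h3, ← h4]
    all_goals first
      | omega
      | simp

theorem wave_apply (s n A B l c e : ℕ) : wave q s (expo n A B l c e) =
    if c = 0 ∧ e = 0 ∧ n + A + B + l = s then
      (beta q s * waveCoeff q s (A + n) (B + n) n) • waveWord q n A B l else 0 := by
  have hs : ∀ (ι : Type) (S : Finset ι) (f : ι → Field q) (d : Var →₀ ℕ),
      (∑ i ∈ S, f i) d = ∑ i ∈ S, f i d := fun ι S f d => map_sum (MvPowerSeries.coeff d) f S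
  change beta q s • ((∑ a ∈ Finset.range (s + 1), ∑ b ∈ Finset.range (s + 1),
    ∑ n ∈ Finset.range (s + 1), _ : Field q) (expo n A B l c e)) = _
  simp only [waveTerm_eq, hs, smul_waveTerm_apply, Finset.sum_ite_eq', Finset.mem_range]
  by_cases h : c = 0 ∧ e = 0 ∧ n + A + B + l = s
  · simp only [if_pos h]
    have hA : A + n < s + 1 := by omega
    have hB : B + n < s + 1 := by omega
    have hn : n < s + 1 := by omega
    simp only [if_pos hn, Finset.sum_ite_eq', Finset.mem_range, if_pos hB, if_pos hA, smul_smul]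
  · simp only [if_neg h, ite_self, Finset.sum_const_zero, smul_zero]

/-- The numerical factor of `v^n x_-^A x_+^B v̄^l` in the `q`-plane wave, up to normalization. -/
def waveConst (q : ℂ) (n A B l : ℕ) : ℂ :=
  (-1) ^ l * (-1) ^ n * q ^ ((n : ℤ) * l - n * A + n * B + A * B + A * l - B * l - A + B) *
    ((qfact q A)⁻¹ * (qfact q B)⁻¹ * (qfact q l)⁻¹ * (qfact q n)⁻¹)

theorem waveCoeff_eq_waveConst (n A B l : ℕ) :
    waveCoeff q (n + A + B + l) (A + n) (B + n) n = waveConst q n A B l := by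
  have h1 : (((A + n : ℕ) : ℤ) - n + 1) = (A : ℤ) + 1 := by push_cast; ring
  have h2 : (((B + n : ℕ) : ℤ) - n + 1) = (B : ℤ) + 1 := by push_cast; ring
  have h3 : (((n + A + B + l : ℕ) : ℤ) - (A + n : ℕ) - (B + n : ℕ) + n + 1) = (l : ℤ) + 1 := by
    push_cast; ring
  have h4 : (((n + A + B + l : ℕ) : ℤ) - (A + n : ℕ) - (B + n : ℕ)) = (l : ℤ) - n := by
    push_cast; ring
  rw [waveCoeff, h1, h2, h3, h4, invGammaQ_add_one, invGammaQ_add_one, invGammaQ_add_one,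
    waveConst]
  congr 1
  congr 1
  -- The sign $(-1)^{l-n}$ becomes $(-1)^l(-1)^n$, because $-1$ is its own inverse.
  · rw [zpow_sub₀ (by norm_num), zpow_natCast, zpow_natCast, div_eq_mul_inv, ← inv_pow]
    norm_num
  · congr 1
    push_cast
    ring

/-- The exponent of $q$ is affine in each of $n,A,B,l$ separately. Raising one of them therefore
multiplies the constant by a power of $q$ in the others, divided by the $q$-number from the
factorial; the sign changes only for $n$ and $l$. The same holds in the next three lemmas. -/
theorem waveConst_succ_v (hq : q ≠ 0) (n A B l : ℕ) : waveConst q (n + 1) A B l =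
    -((qint q ((n : ℤ) + 1))⁻¹ * (q ^ l * q ^ B * (q ^ A)⁻¹)) * waveConst q n A B l := by
  have h : ∀ k : ℤ, q ^ (k + l + B - A) = q ^ k * (q ^ l * q ^ B * (q ^ A)⁻¹) := fun k => by
    rw [zpow_sub₀ hq, zpow_add₀ hq, zpow_add₀ hq, zpow_natCast, zpow_natCast, zpow_natCast]
    ring
  rw [waveConst, waveConst, qfact_succ, mul_inv, pow_succ (-1 : ℂ) n]
  rw [show (((n + 1 : ℕ) : ℤ) * l - (n + 1 : ℕ) * A + (n + 1 : ℕ) * B + A * B + A * l - B * l - A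
    + B) = ((n : ℤ) * l - n * A + n * B + A * B + A * l - B * l - A + B) + l + B - A by
      push_cast; ring, h]
  ring

theorem waveConst_succ_minus (hq : q ≠ 0) (n A B l : ℕ) : waveConst q n (A + 1) B l =
    ((qint q ((A : ℤ) + 1))⁻¹ * (q ^ B * q ^ l * (q ^ n)⁻¹ * q⁻¹)) * waveConst q n A B l := by
  have h : ∀ k : ℤ, q ^ (k + B + l - n - 1) = q ^ k * (q ^ B * q ^ l * (q ^ n)⁻¹ * q⁻¹) :=
    fun k => by
      rw [zpow_sub₀ hq, zpow_sub₀ hq, zpow_add₀ hq, zpow_add₀ hq, zpow_natCast, zpow_natCast,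
        zpow_natCast, zpow_one]
      ring
  rw [waveConst, waveConst, qfact_succ, mul_inv]
  rw [show ((n : ℤ) * l - n * (A + 1 : ℕ) + n * B + (A + 1 : ℕ) * B + (A + 1 : ℕ) * l - B * l -
    (A + 1 : ℕ) + B) =
      ((n : ℤ) * l - n * A + n * B + A * B + A * l - B * l - A + B) + B + l - n - 1 by
      push_cast; ring, h]
  ring

theorem waveConst_succ_plus (hq : q ≠ 0) (n A B l : ℕ) : waveConst q n A (B + 1) l =
    ((qint q ((B : ℤ) + 1))⁻¹ * (q ^ n * q ^ A * (q ^ l)⁻¹ * q)) * waveConst q n A B l := by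
  have h : ∀ k : ℤ, q ^ (k + n + A - l + 1) = q ^ k * (q ^ n * q ^ A * (q ^ l)⁻¹ * q) :=
    fun k => by
      rw [zpow_add₀ hq, zpow_sub₀ hq, zpow_add₀ hq, zpow_add₀ hq, zpow_natCast, zpow_natCast,
        zpow_natCast, zpow_one]
      ring
  rw [waveConst, waveConst, qfact_succ, mul_inv]
  rw [show ((n : ℤ) * l - n * A + n * (B + 1 : ℕ) + A * (B + 1 : ℕ) + A * l - (B + 1 : ℕ) * l -
    A + (B + 1 : ℕ)) =
      ((n : ℤ) * l - n * A + n * B + A * B + A * l - B * l - A + B) + n + A - l + 1 by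
      push_cast; ring, h]
  ring

theorem waveConst_succ_vbar (hq : q ≠ 0) (n A B l : ℕ) : waveConst q n A B (l + 1) =
    -((qint q ((l : ℤ) + 1))⁻¹ * (q ^ n * q ^ A * (q ^ B)⁻¹)) * waveConst q n A B l := by
  have h : ∀ k : ℤ, q ^ (k + n + A - B) = q ^ k * (q ^ n * q ^ A * (q ^ B)⁻¹) := fun k => by
    rw [zpow_sub₀ hq, zpow_add₀ hq, zpow_add₀ hq, zpow_natCast, zpow_natCast, zpow_natCast]
    ring
  rw [waveConst, waveConst, qfact_succ, mul_inv, pow_succ (-1 : ℂ) l]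
  rw [show ((n : ℤ) * (l + 1 : ℕ) - n * A + n * B + A * B + A * (l + 1 : ℕ) - B * (l + 1 : ℕ) - A
    + B) = ((n : ℤ) * l - n * A + n * B + A * B + A * l - B * l - A + B) + n + A - B by
      push_cast; ring, h]
  ring

/-- The coefficient of `v^n x_-^A x_+^B v̄^l` in the part of degree `s - 1` of the `q`-plane wave,
with the normalization of the part of degree `s`. -/
def lowWave (q : ℂ) (s n A B l : ℕ) : MomSeries q :=
  if n + A + B + l + 1 = s then (beta q s * waveConst q n A B l) • waveWord q n A B l else 0

theorem wave_apply_add (n A B l : ℕ) : wave q (n + A + B + l) (expo n A B l 0 0) =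
    (beta q (n + A + B + l) * waveConst q n A B l) • waveWord q n A B l := by
  rw [wave_apply, if_pos ⟨rfl, rfl, rfl⟩, waveCoeff_eq_waveConst]

theorem wave_apply_of_ne {s n A B l : ℕ} (h : n + A + B + l ≠ s) :
    wave q s (expo n A B l 0 0) = 0 := by
  rw [wave_apply, if_neg (fun h' => h h'.2.2)]

theorem wave_apply_succ_z (s n A B l c e : ℕ) : wave q s (expo n A B l (c + 1) e) = 0 := by
  rw [wave_apply, if_neg (fun h' => Nat.succ_ne_zero c h'.1)]

theorem wave_apply_succ_zbar (s n A B l c e : ℕ) : wave q s (expo n A B l c (e + 1)) = 0 := by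
  rw [wave_apply, if_neg (fun h' => Nat.succ_ne_zero e h'.2.1)]

/-- After multiplication by $[n+1]_q$ this is the coefficient of $\hat{\mathcal D}_vf_s$. This lemma
and its analogues for the other coordinates express all derivatives through the same `lowWave`, with
one momentum on its left. -/
theorem wave_succ_v (hq : q ≠ 0) (s n A B l : ℕ) : wave q s (expo (n + 1) A B l 0 0) =
    -((qint q ((n : ℤ) + 1))⁻¹ * q ^ l) • (kmom q .vbar * lowWave q s n A B l) := by
  by_cases h : n + A + B + l + 1 = s
  · obtain rfl : n + 1 + A + B + l = s := by omega
    rw [wave_apply_add, lowWave, if_pos h, waveConst_succ_v hq, waveWord_succ_v, mul_smul_comm,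
      smul_smul, smul_smul]
    congr 1
    simp only [inv_pow]
    field_simp
  · rw [wave_apply_of_ne (by omega), lowWave, if_neg h, mul_zero, smul_zero]

theorem wave_succ_minus (hq : q ≠ 0) (s n A B l : ℕ) : wave q s (expo n (A + 1) B l 0 0) =
    ((qint q ((A : ℤ) + 1))⁻¹ * ((q ^ B)⁻¹ * (q ^ n)⁻¹ * q⁻¹)) •
      (kmom q .plus * lowWave q s n A B l) := by
  by_cases h : n + A + B + l + 1 = s
  · obtain rfl : n + (A + 1) + B + l = s := by omega
    rw [wave_apply_add, lowWave, if_pos h, waveConst_succ_minus hq, waveWord_succ_minus hq,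
      mul_smul_comm, smul_smul, smul_smul]
    congr 1
    simp only [inv_pow]
    field_simp
    ring
  · rw [wave_apply_of_ne (by omega), lowWave, if_neg h, mul_zero, smul_zero]

theorem wave_succ_plus (hq : q ≠ 0) (s n A B l : ℕ) : wave q s (expo n A (B + 1) l 0 0) =
    ((qint q ((B : ℤ) + 1))⁻¹ * (q ^ n * q ^ A * q)) •
      (kmom q .minus * lowWave q s n A B l) := by
  by_cases h : n + A + B + l + 1 = s
  · obtain rfl : n + A + (B + 1) + l = s := by omega
    rw [wave_apply_add, lowWave, if_pos h, waveConst_succ_plus hq, waveWord_succ_plus hq,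
      mul_smul_comm, smul_smul, smul_smul]
    congr 1
    field_simp
  · rw [wave_apply_of_ne (by omega), lowWave, if_neg h, mul_zero, smul_zero]

theorem wave_succ_vbar (hq : q ≠ 0) (s n A B l : ℕ) : wave q s (expo n A B (l + 1) 0 0) =
    -((qint q ((l : ℤ) + 1))⁻¹ * (q ^ n * q ^ A * (q ^ B)⁻¹)) •
      (kmom q .v * lowWave q s n A B l) := by
  by_cases h : n + A + B + l + 1 = s
  · obtain rfl : n + A + B + (l + 1) = s := by omega
    rw [wave_apply_add, lowWave, if_pos h, waveConst_succ_vbar hq, waveWord_succ_vbar,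
      mul_smul_comm, smul_smul]
    congr 1
    ring
  · rw [wave_apply_of_ne (by omega), lowWave, if_neg h, mul_zero, smul_zero]

theorem plus_mul_minus_mul (x : MomSeries q) : kmom q .plus * (kmom q .minus * x) =
    q • (kmom q .v * (kmom q .vbar * x)) := by
  rw [← mul_assoc, plus_mul_minus, smul_mul_assoc, mul_assoc]

/-- The massless wave equation: `M_v D_- D_+` acts on the `q`-plane wave as a multiple of
`[N_v] D_v̄` does. -/
theorem wave_succ_minus_succ_plus (hq : q ≠ 0) (hq' : ∀ n : ℕ, qint q ((n : ℤ) + 1) ≠ 0)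
    (s n A B l : ℕ) : wave q s (expo n (A + 1) (B + 1) l 0 0) =
    -((qint q ((A : ℤ) + 1))⁻¹ * (qint q ((B : ℤ) + 1))⁻¹ * qint q ((n : ℤ) + 1) *
      (q ^ A * (q ^ B)⁻¹ * (q ^ l)⁻¹)) • (kmom q .v * lowWave q s (n + 1) A B l) := by
  have hn := hq' n
  by_cases h : n + 1 + A + B + l + 1 = s
  · obtain rfl : n + (A + 1) + (B + 1) + l = s := by omega
    -- Both sides are brought down to the word with exponents $(n,A,B,l)$: the left gives $k_+k_-$,
    -- the right $k_vk_{\bar v}$, and these agree up to the factor $q$ on the cone.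
    rw [wave_apply_add, lowWave, if_pos h, waveConst_succ_minus hq, waveWord_succ_minus hq,
      waveConst_succ_plus hq, waveWord_succ_plus hq, waveConst_succ_v hq, waveWord_succ_v]
    simp only [mul_smul_comm, smul_smul, plus_mul_minus_mul]
    congr 1
    simp only [inv_pow]
    field_simp
    ring
  · rw [wave_apply_of_ne (by omega), lowWave, if_neg h, mul_zero, smul_zero]

/-! ### The Maxwell operators in coordinates -/

theorem T_apply (κ : Var) (e : ℤ) (F : Field q) (d : Var →₀ ℕ) :
    T q κ e F d = q ^ (e * (d κ : ℤ)) • F d := rfl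

theorem qnum_apply (c : ℤ) (κ : Var) (F : Field q) (d : Var →₀ ℕ) :
    qnum q c κ F d = qint q (c - (d κ : ℤ)) • F d := rfl

theorem M_apply (κ : Var) (F : Field q) : M q κ F = var q κ * F := rfl

theorem field_add_apply (F G : Field q) (d : Var →₀ ℕ) : (F + G) d = F d + G d := rfl

theorem field_sub_apply (F G : Field q) (d : Var →₀ ℕ) : (F - G) d = F d - G d := rfl

theorem field_smul_apply (c : ℂ) (F : Field q) (d : Var →₀ ℕ) : (c • F) d = c • F d := rfl

theorem field_zero_apply (d : Var →₀ ℕ) : (0 : Field q) d = 0 := rfl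

theorem linear_z_mul_apply (a b : Mom) (t : ℂ) (F : Field q) (n A B l c e : ℕ) :
    ((mom q a - t • (var q .z * mom q b)) * F : Field q) (expo n A B l c e) =
      kmom q a * F (expo n A B l c e) -
        t • (if c = 0 then 0 else kmom q b * F (expo n A B l (c - 1) e)) := by
  rw [sub_mul, smul_mul_assoc, mul_assoc, field_sub_apply, field_smul_apply, z_mul_apply,
    mom_eq_C, mom_eq_C, C_mul_apply, C_mul_apply]

theorem linear_zbar_mul_apply (a b : Mom) (t : ℂ) (F : Field q) (n A B l c e : ℕ) :
    ((mom q a - t • (var q .zbar * mom q b)) * F : Field q) (expo n A B l c e) =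
      kmom q a * F (expo n A B l c e) -
        t • (if e = 0 then 0 else kmom q b * F (expo n A B l c (e - 1))) := by
  rw [sub_mul, smul_mul_assoc, mul_assoc, field_sub_apply, field_smul_apply, zbar_mul_apply,
    mom_eq_C, mom_eq_C, C_mul_apply, C_mul_apply]

theorem linear_zbar_mul_apply' (a b : Mom) (F : Field q) (n A B l c e : ℕ) :
    ((mom q a - var q .zbar * mom q b) * F : Field q) (expo n A B l c e) =
      kmom q a * F (expo n A B l c e) -
        if e = 0 then 0 else kmom q b * F (expo n A B l c (e - 1)) := by
  have h := linear_zbar_mul_apply a b 1 F n A B l c e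
  rwa [one_smul, one_smul] at h

/-- In this form $\lambda$ cancels the $[n+1]_q$ produced by `wave_succ_minus_succ_plus`. What is
left, $q^{n+1}-q^{-(n+1)}$, combines with the powers of $q$ of the $\hat{\mathcal D}_{\bar v}$ term.
-/
theorem lam_eq_div (hq : q ≠ 0) (hroot : ∀ N : ℕ, 0 < N → q ^ N = 1 → q = 1) (n : ℕ) :
    lam q = (q ^ (n + 1) - (q ^ (n + 1))⁻¹) / qint q ((n : ℤ) + 1) := by
  rw [eq_div_iff (qint_ne_zero hq hroot n), lam_mul_qint _ hroot hq, zpow_neg]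
  norm_cast

theorem lowWave_of_ne {s n A B l : ℕ} (h : n + A + B + l + 1 ≠ s) : lowWave q s n A B l = 0 :=
  if_neg h

theorem kmom_mul_neg (κ : Mom) (x : MomSeries q) : kmom q κ * -x = -(kmom q κ * x) :=
  (AddMonoidHom.mulLeft (kmom q κ)).map_neg x

set_option linter.unusedSimpArgs false in
-- `h₁` merges the two mixed products of the factors. `h₂` balances $\hat{\mathcal D}_-\sim k_+$
-- against $\hat{\mathcal D}_v\sim k_{\bar v}$ in the part without $\bar z$, and `h₃` balances
-- $\hat{\mathcal D}_+\sim k_-$ against $\hat{\mathcal D}_{\bar v}\sim k_v$ in the part linear in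
-- $\bar z$. The $q^s$ in the factors compensates the powers of $q$ that depend on the total degree
-- of the monomial.
theorem Iplus_linear_mul_linear_mul_wave (hq : q ≠ 0)
    (hroot : ∀ N : ℕ, 0 < N → q ^ N = 1 → q = 1) (s : ℕ) {a₁ b₁ a₂ b₂ : Mom}
    (h₁ : kmom q b₁ * kmom q a₂ = q⁻¹ • (kmom q a₁ * kmom q b₂))
    (h₂ : kmom q b₂ * kmom q .plus = q⁻¹ • (kmom q a₂ * kmom q .vbar))
    (h₃ : kmom q a₂ * kmom q .minus = q • (kmom q b₂ * kmom q .v)) :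
    Iplus q 0 ((mom q a₁ - q ^ (s + 6) • (var q .z * mom q b₁)) *
      ((mom q a₂ - q ^ (s + 3) • (var q .z * mom q b₂)) * wave q s)) = 0 := by
  have h₁' : ∀ x, kmom q b₁ * (kmom q a₂ * x) = q⁻¹ • (kmom q a₁ * (kmom q b₂ * x)) := fun x => by
    rw [← mul_assoc, h₁, smul_mul_assoc, mul_assoc]
  have h₁'' : ∀ x, kmom q a₁ * (kmom q b₂ * x) = q • (kmom q b₁ * (kmom q a₂ * x)) := fun x => by
    rw [h₁', smul_smul, mul_inv_cancel₀ hq, one_smul]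
  have h₂' : ∀ x, kmom q b₂ * (kmom q .plus * x) = q⁻¹ • (kmom q a₂ * (kmom q .vbar * x)) :=
    fun x => by rw [← mul_assoc, h₂, smul_mul_assoc, mul_assoc]
  have h₃' : ∀ x, kmom q a₂ * (kmom q .minus * x) = q • (kmom q b₂ * (kmom q .v * x)) :=
    fun x => by rw [← mul_assoc, h₃, smul_mul_assoc, mul_assoc]
  refine field_ext_expo fun n A B l c e => ?_
  have hA := qint_ne_zero hq hroot A
  have hB := qint_ne_zero hq hroot B
  have hn := qint_ne_zero hq hroot n
  have hl := qint_ne_zero hq hroot l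
  have hq2 : qint q 2 = q + q⁻¹ := qint_two hroot hq
  have hq1 : qint q 1 = 1 := qint_one hroot hq
  have e1 : (2 : ℤ) - 1 = 1 := by norm_num
  have e2 : (1 : ℤ) + 1 = 2 := by norm_num
  simp only [Iplus, LinearMap.smul_apply, Module.End.mul_apply, LinearMap.sub_apply,
    LinearMap.add_apply, field_add_apply, field_sub_apply, field_smul_apply, T_apply, qnum_apply,
    M_apply, D_v_apply, D_minus_apply, D_plus_apply, D_vbar_apply, D_z_apply, field_zero_apply,
    v_mul_apply, zbar_mul_apply, expo_v, expo_minus, expo_plus, expo_vbar, expo_z, expo_zbar,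
    linear_z_mul_apply]
  -- The wave is free of $z,\bar z$ and the operator multiplies by at most one $\bar z$, so only
  -- $\bar z^0$ and $\bar z^1$ matter. The factors have degree at most $2$ in $z$; at $z^2$ the
  -- factor $[2-2]_q$ and the absence of $z^3$ kill both terms, so only $z^0$ and $z^1$ give
  -- equations.
  rcases e with _ | _ | e
  · rcases c with _ | _ | _ | c
    all_goals
      simp only [if_pos, Nat.add_eq_zero_iff, one_ne_zero, and_false, if_false, ite_self,
        wave_apply_succ_z, wave_apply_succ_zbar, mul_zero, smul_zero, sub_zero, add_zero,
        zero_add, Nat.sub_self, Nat.add_sub_cancel, Nat.cast_zero, Nat.cast_add, Nat.cast_one,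
        hq1, hq2, e1, e2, sub_self, zero_sub, qint_zero, zero_smul, neg_zero,
        wave_succ_v hq, wave_succ_minus hq]
    all_goals
      -- Off this degree every coefficient vanishes. On it, substituting for $s$ makes the powers
      -- $q^{s+3},q^{s+6}$ comparable with those of the wave.
      by_cases hs : n + A + B + l + 1 = s
      on_goal 2 => simp only [lowWave_of_ne hs, mul_zero, smul_zero, sub_zero, neg_zero]
    -- At $z^0$ all words become $a_1a_2k_{\bar v}$.
    · simp only [h₁', h₂', mul_smul_comm, kmom_mul_neg, smul_sub, smul_neg, smul_smul]
      subst hs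
      match_scalars
      simp only [zpow_neg, zpow_add₀ hq, one_mul, neg_mul, zpow_natCast, zpow_one, zpow_zero]
      field_simp
      ring
    -- At $z^1$ the exchange runs in the opposite direction, and all words become $b_1a_2k_{\bar
    -- v}$.
    · simp only [h₁'', h₂', mul_smul_comm, kmom_mul_neg, smul_sub, smul_neg, smul_smul]
      subst hs
      match_scalars
      simp only [zpow_neg, zpow_add₀ hq, one_mul, neg_mul, zpow_natCast, zpow_one, zpow_zero]
      field_simp
      ring
  · rcases c with _ | _ | _ | c
    all_goals
      -- The term with $\hat M_v\hat{\mathcal D}_-\hat{\mathcal D}_+$ is absent at $v^0$.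
      rcases n with _ | n
      all_goals
        simp only [if_pos, Nat.add_eq_zero_iff, one_ne_zero, and_false, if_false, ite_self,
          wave_apply_succ_z, wave_apply_succ_zbar, mul_zero, smul_zero, sub_zero, add_zero,
          zero_add, Nat.sub_self, Nat.add_sub_cancel, Nat.cast_zero, Nat.cast_add, Nat.cast_one,
          hq1, hq2, e1, e2, sub_self, zero_sub, qint_zero, zero_smul, neg_zero,
          wave_succ_minus_succ_plus hq (qint_ne_zero hq hroot)]
        try simp only [wave_succ_vbar hq, wave_succ_plus hq]
    · by_cases hs : 0 + A + B + l + 1 = s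
      on_goal 2 => simp only [lowWave_of_ne hs, mul_zero, smul_zero, sub_zero, neg_zero]
      simp only [h₁', h₃', mul_smul_comm, kmom_mul_neg, smul_sub, smul_neg, smul_smul]
      subst hs
      match_scalars
      simp only [zpow_neg, zpow_add₀ hq, one_mul, neg_mul, zpow_natCast, zpow_one, zpow_zero]
      field_simp
      ring
    · by_cases hs : n + 1 + A + B + l + 1 = s
      on_goal 2 => simp only [lowWave_of_ne hs, mul_zero, smul_zero, sub_zero, neg_zero]
      have hn := qint_ne_zero hq hroot n
      rw [lam_eq_div hq hroot n]
      simp only [h₁', h₃', mul_smul_comm, kmom_mul_neg, smul_sub, smul_neg, smul_smul]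
      subst hs
      match_scalars
      simp only [zpow_neg, zpow_add₀ hq, one_mul, neg_mul, zpow_natCast, zpow_one, zpow_zero]
      field_simp
      ring
    · by_cases hs : 0 + A + B + l + 1 = s
      on_goal 2 => simp only [lowWave_of_ne hs, mul_zero, smul_zero, sub_zero, neg_zero]
      simp only [h₁'', h₃', mul_smul_comm, kmom_mul_neg, smul_sub, smul_neg, smul_smul]
      subst hs
      match_scalars
      simp only [zpow_neg, zpow_add₀ hq, one_mul, neg_mul, zpow_natCast, zpow_one, zpow_zero]
      field_simp
      ring
    · by_cases hs : n + 1 + A + B + l + 1 = s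
      on_goal 2 => simp only [lowWave_of_ne hs, mul_zero, smul_zero, sub_zero, neg_zero]
      have hn := qint_ne_zero hq hroot n
      rw [lam_eq_div hq hroot n]
      simp only [h₁'', h₃', mul_smul_comm, kmom_mul_neg, smul_sub, smul_neg, smul_smul]
      subst hs
      match_scalars
      simp only [zpow_neg, zpow_add₀ hq, one_mul, neg_mul, zpow_natCast, zpow_one, zpow_zero]
      field_simp
      ring
  all_goals simp only [if_pos, Nat.add_eq_zero_iff, one_ne_zero, and_false, if_false, ite_self,
          wave_apply_succ_z, wave_apply_succ_zbar, mul_zero, smul_zero, sub_zero, add_zero,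
          zero_add, Nat.sub_self, Nat.add_sub_cancel, sub_self, zero_sub, neg_zero]

set_option linter.unusedSimpArgs false in
-- The mechanism is that of `Iplus_linear_mul_linear_mul_wave` with $z$ and $\bar z$ exchanged and
-- $k_v,k_{\bar v}$ exchanged in `h₂` and `h₃`. Here $a_1b_2+q^{-1}b_1a_2=q^{-1}[2]_q\,a_1b_2$, and
-- the operator produces no power depending on the total degree, so the factors are free of $s$.
theorem Iminus_linear_mul_linear_mul_wave (hq : q ≠ 0)
    (hroot : ∀ N : ℕ, 0 < N → q ^ N = 1 → q = 1) (s : ℕ) {a₁ b₁ a₂ b₂ : Mom}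
    (h₁ : kmom q b₁ * kmom q a₂ = q⁻¹ • (kmom q a₁ * kmom q b₂))
    (h₂ : kmom q b₂ * kmom q .plus = q⁻¹ • (kmom q a₂ * kmom q .v))
    (h₃ : kmom q a₂ * kmom q .minus = q • (kmom q b₂ * kmom q .vbar)) :
    Iminus q 0 ((mom q a₁ - q⁻¹ • (var q .zbar * mom q b₁)) *
      ((mom q a₂ - var q .zbar * mom q b₂) * wave q s)) = 0 := by
  have h₁' : ∀ x, kmom q b₁ * (kmom q a₂ * x) = q⁻¹ • (kmom q a₁ * (kmom q b₂ * x)) := fun x => by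
    rw [← mul_assoc, h₁, smul_mul_assoc, mul_assoc]
  have h₁'' : ∀ x, kmom q a₁ * (kmom q b₂ * x) = q • (kmom q b₁ * (kmom q a₂ * x)) := fun x => by
    rw [h₁', smul_smul, mul_inv_cancel₀ hq, one_smul]
  have h₂' : ∀ x, kmom q b₂ * (kmom q .plus * x) = q⁻¹ • (kmom q a₂ * (kmom q .v * x)) :=
    fun x => by rw [← mul_assoc, h₂, smul_mul_assoc, mul_assoc]
  have h₃' : ∀ x, kmom q a₂ * (kmom q .minus * x) = q • (kmom q b₂ * (kmom q .vbar * x)) :=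
    fun x => by rw [← mul_assoc, h₃, smul_mul_assoc, mul_assoc]
  refine field_ext_expo fun n A B l c e => ?_
  have hA := qint_ne_zero hq hroot A
  have hB := qint_ne_zero hq hroot B
  have hn := qint_ne_zero hq hroot n
  have hl := qint_ne_zero hq hroot l
  have hq2 : qint q 2 = q + q⁻¹ := qint_two hroot hq
  have hq1 : qint q 1 = 1 := qint_one hroot hq
  have e1 : (2 : ℤ) - 1 = 1 := by norm_num
  have e2 : (1 : ℤ) + 1 = 2 := by norm_num
  simp only [Iminus, LinearMap.smul_apply, Module.End.mul_apply, LinearMap.sub_apply,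
    LinearMap.add_apply, field_add_apply, field_sub_apply, field_smul_apply, T_apply, qnum_apply,
    M_apply, D_v_apply, D_minus_apply, D_plus_apply, D_vbar_apply, D_zbar_apply, field_zero_apply,
    v_mul_apply, z_mul_apply, expo_v, expo_minus, expo_plus, expo_vbar, expo_z, expo_zbar,
    linear_zbar_mul_apply, linear_zbar_mul_apply']
  rcases c with _ | _ | c
  · rcases e with _ | _ | _ | e
    all_goals
      rcases n with _ | n
      all_goals
        simp only [if_pos, Nat.add_eq_zero_iff, one_ne_zero, and_false, if_false, ite_self,
          wave_apply_succ_z, wave_apply_succ_zbar, mul_zero, smul_zero, sub_zero, add_zero,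
          zero_add, Nat.sub_self, Nat.add_sub_cancel, Nat.cast_zero, Nat.cast_add, Nat.cast_one,
          hq1, hq2, e1, e2, sub_self, zero_sub, qint_zero, zero_smul, neg_zero,
          wave_succ_minus_succ_plus hq (qint_ne_zero hq hroot)]
        try simp only [wave_succ_vbar hq, wave_succ_minus hq]
    · by_cases hs : 0 + A + B + l + 1 = s
      on_goal 2 => simp only [lowWave_of_ne hs, mul_zero, smul_zero, sub_zero, add_zero, neg_zero]
      simp only [h₁', h₂', mul_smul_comm, kmom_mul_neg, smul_sub, smul_neg, smul_smul]
      subst hs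
      match_scalars
      simp only [zpow_neg, zpow_add₀ hq, one_mul, neg_mul, zpow_natCast, zpow_one, zpow_zero]
      field_simp
      ring
    · by_cases hs : n + 1 + A + B + l + 1 = s
      on_goal 2 => simp only [lowWave_of_ne hs, mul_zero, smul_zero, sub_zero, add_zero, neg_zero]
      have hn := qint_ne_zero hq hroot n
      rw [lam_eq_div hq hroot n]
      simp only [h₁', h₂', mul_smul_comm, kmom_mul_neg, smul_sub, smul_neg, smul_smul]
      subst hs
      match_scalars
      simp only [zpow_neg, zpow_add₀ hq, one_mul, neg_mul, zpow_natCast, zpow_one, zpow_zero]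
      field_simp
      ring
    · by_cases hs : 0 + A + B + l + 1 = s
      on_goal 2 => simp only [lowWave_of_ne hs, mul_zero, smul_zero, sub_zero, add_zero, neg_zero]
      simp only [h₁'', h₂', mul_smul_comm, kmom_mul_neg, smul_sub, smul_neg, smul_smul]
      subst hs
      match_scalars
      simp only [zpow_neg, zpow_add₀ hq, one_mul, neg_mul, zpow_natCast, zpow_one, zpow_zero]
      field_simp
      ring
    · by_cases hs : n + 1 + A + B + l + 1 = s
      on_goal 2 => simp only [lowWave_of_ne hs, mul_zero, smul_zero, sub_zero, add_zero, neg_zero]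
      have hn := qint_ne_zero hq hroot n
      rw [lam_eq_div hq hroot n]
      simp only [h₁'', h₂', mul_smul_comm, kmom_mul_neg, smul_sub, smul_neg, smul_smul]
      subst hs
      match_scalars
      simp only [zpow_neg, zpow_add₀ hq, one_mul, neg_mul, zpow_natCast, zpow_one, zpow_zero]
      field_simp
      ring
  · rcases e with _ | _ | _ | e
    all_goals
      simp only [if_pos, Nat.add_eq_zero_iff, one_ne_zero, and_false, if_false, ite_self,
      wave_apply_succ_z, wave_apply_succ_zbar, mul_zero, smul_zero, sub_zero, add_zero,
      zero_add, Nat.sub_self, Nat.add_sub_cancel, Nat.cast_zero, Nat.cast_add, Nat.cast_one,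
      hq1, hq2, e1, e2, sub_self, zero_sub, qint_zero, zero_smul, neg_zero,
        wave_succ_v hq, wave_succ_plus hq]
    · by_cases hs : n + A + B + l + 1 = s
      on_goal 2 => simp only [lowWave_of_ne hs, mul_zero, smul_zero, sub_zero, add_zero, neg_zero]
      simp only [h₁', h₃', mul_smul_comm, kmom_mul_neg, smul_sub, smul_neg, smul_smul]
      subst hs
      match_scalars
      simp only [zpow_neg, zpow_add₀ hq, one_mul, neg_mul, zpow_natCast, zpow_one, zpow_zero]
      field_simp
      ring
    · by_cases hs : n + A + B + l + 1 = s
      on_goal 2 => simp only [lowWave_of_ne hs, mul_zero, smul_zero, sub_zero, add_zero, neg_zero]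
      simp only [h₁'', h₃', mul_smul_comm, kmom_mul_neg, smul_sub, smul_neg, smul_smul]
      subst hs
      match_scalars
      simp only [zpow_neg, zpow_add₀ hq, one_mul, neg_mul, zpow_natCast, zpow_one, zpow_zero]
      field_simp
      ring
  all_goals
    simp only [if_pos, Nat.add_eq_zero_iff, one_ne_zero, and_false, if_false, ite_self,
    wave_apply_succ_z, wave_apply_succ_zbar, mul_zero, smul_zero, sub_zero, add_zero,
    zero_add, Nat.sub_self, Nat.add_sub_cancel, Nat.cast_zero, Nat.cast_add, Nat.cast_one,
    hq1, hq2, e1, e2, sub_self, zero_sub, qint_zero, zero_smul, neg_zero]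

/-! ### Degrees in the momenta -/

theorem momHomogeneous_linear (a b : Mom) (κ : Var) (t : ℂ) :
    MomHomogeneous 1 (mom q a - t • (var q κ * mom q b)) :=
  (momHomogeneous_mom a).sub
    (((momHomogeneous_var κ).mul (momHomogeneous_mom b)).smul t)

theorem momHomogeneous_linear' (a b : Mom) (κ : Var) :
    MomHomogeneous 1 (mom q a - var q κ * mom q b) :=
  (momHomogeneous_mom a).sub ((momHomogeneous_var κ).mul (momHomogeneous_mom b))

theorem momHomogeneous_mom_pow (κ : Mom) (n : ℕ) : MomHomogeneous n (mom q κ ^ n) :=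
  ((momHomogeneous_mom κ).pow n).congr (mul_one n)

theorem momHomogeneous_plusPoly (m s : ℕ) (p : Consts) :
    MomHomogeneous (m + 2) (plusPoly q m s p) := by
  refine MomHomogeneous.sum fun i hi => ?_
  have hi := Finset.mem_range.1 hi
  refine ((MomHomogeneous.sum fun j hj => ?_).add ?_).add (MomHomogeneous.sum fun j hj => ?_)
  · have hj := Finset.mem_range.1 hj
    exact MomHomogeneous.smul _ <| ((((((momHomogeneous_mom_pow _ _).mul
      (momHomogeneous_mom_pow _ _)).mul (momHomogeneous_mom_pow _ _)).mul
      (momHomogeneous_linear _ _ _ _)).mul (momHomogeneous_linear _ _ _ _)).congr (by omega))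
  · exact MomHomogeneous.smul _ <| (((((momHomogeneous_mom_pow _ _).mul
      (momHomogeneous_mom_pow _ _)).mul
      (momHomogeneous_linear _ _ _ _)).mul (momHomogeneous_linear _ _ _ _)).congr (by omega))
  · have hj := Finset.mem_range.1 hj
    exact MomHomogeneous.smul _ <| ((((((momHomogeneous_mom_pow _ _).mul
      (momHomogeneous_mom_pow _ _)).mul (momHomogeneous_mom_pow _ _)).mul
      (momHomogeneous_linear _ _ _ _)).mul (momHomogeneous_linear _ _ _ _)).congr (by omega))

theorem momHomogeneous_minusPoly (m : ℕ) (r : Consts) :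
    MomHomogeneous (m + 2) (minusPoly q m r) := by
  refine MomHomogeneous.sum fun i hi => ?_
  have hi := Finset.mem_range.1 hi
  refine ((MomHomogeneous.sum fun j hj => ?_).add ?_).add (MomHomogeneous.sum fun j hj => ?_)
  · have hj := Finset.mem_range.1 hj
    exact MomHomogeneous.smul _ <| ((((((momHomogeneous_mom_pow _ _).mul
      (momHomogeneous_mom_pow _ _)).mul (momHomogeneous_mom_pow _ _)).mul
      (momHomogeneous_linear _ _ _ _)).mul (momHomogeneous_linear' _ _ _)).congr (by omega))
  · exact MomHomogeneous.smul _ <| (((((momHomogeneous_mom_pow _ _).mul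
      (momHomogeneous_mom_pow _ _)).mul
      (momHomogeneous_linear _ _ _ _)).mul (momHomogeneous_linear' _ _ _)).congr (by omega))
  · have hj := Finset.mem_range.1 hj
    exact MomHomogeneous.smul _ <| ((((((momHomogeneous_mom_pow _ _).mul
      (momHomogeneous_mom_pow _ _)).mul (momHomogeneous_mom_pow _ _)).mul
      (momHomogeneous_linear _ _ _ _)).mul (momHomogeneous_linear' _ _ _)).congr (by omega))

theorem momHomogeneous_var_pow (κ : Var) (n : ℕ) : MomHomogeneous 0 (var q κ ^ n) :=
  ((momHomogeneous_var κ).pow n).congr (mul_zero n)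

theorem momHomogeneous_wave (s : ℕ) : MomHomogeneous s (wave q s) := by
  refine MomHomogeneous.smul _ <| MomHomogeneous.sum fun a _ => MomHomogeneous.sum fun b _ =>
    MomHomogeneous.sum fun n _ => ?_
  -- The momentum exponents add up to $s$ only if no subtraction is truncated; otherwise the
  -- coefficient is zero.
  by_cases h : a < n ∨ b < n ∨ s + n < a + b
  · rw [waveCoeff_eq_zero h, zero_smul]
    exact momHomogeneous_zero s
  · exact MomHomogeneous.smul _ <| (((((momHomogeneous_mom_pow _ _).mul
      (momHomogeneous_mom_pow _ _)).mul (momHomogeneous_mom_pow _ _)).mul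
      (momHomogeneous_mom_pow _ _)).mul ((((momHomogeneous_var_pow _ _).mul
      (momHomogeneous_var_pow _ _)).mul (momHomogeneous_var_pow _ _)).mul
      (momHomogeneous_var_pow _ _))).congr (by omega)

theorem momHomogeneous_plusTerm (p : ℕ → ℕ → Consts) (ms : ℕ × ℕ) :
    MomHomogeneous (ms.1 + 2 + ms.2) (plusTerm q p ms) :=
  ((momHomogeneous_plusPoly _ _ _).mul (momHomogeneous_wave _)).smul _

theorem momHomogeneous_minusTerm (r : ℕ → ℕ → Consts) (ms : ℕ × ℕ) :
    MomHomogeneous (ms.1 + 2 + ms.2) (minusTerm q r ms) :=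
  ((momHomogeneous_minusPoly _ _).mul (momHomogeneous_wave _)).smul _

theorem momHomogeneous_expTerm (s : ℕ) : MomHomogeneous s (expTerm q s) :=
  (momHomogeneous_wave s).smul _

/-! ### Solutions of the homogeneous equations -/

theorem Iplus_plusPoly_mul_wave (hq : q ≠ 0)
    (hroot : ∀ N : ℕ, 0 < N → q ^ N = 1 → q = 1) (m s : ℕ) (p : Consts) :
    Iplus q 0 (plusPoly q m s p * wave q s) = 0 := by
  have hL : ∀ κ, Commute (LinearMap.mulLeft ℂ (mom q κ)) (Iplus q 0) := fun κ =>
    commute_Iplus (commute_mulLeft_mom_diagOp κ) (commute_mulLeft_mom_D κ)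
      (commute_mulLeft_mom_M κ) 0
  have hv := vbar_mul_v (q := q)
  have h := @Iplus_linear_mul_linear_mul_wave q hq hroot s
  -- The pairs $(a,b)$ are $(k_v,k_-)$ and $(k_+,k_{\bar v})$. The three choices belong to the
  -- constants `c1`, `c2`, `c3`.
  have h11 := h minus_mul_v minus_mul_plus (v_mul_minus hq)
  have h12 := @h .v .minus .plus .vbar (by rw [minus_mul_plus])
    (by rw [plus_mul_vbar, smul_smul, inv_mul_cancel₀ hq, one_smul])
    (by rw [plus_mul_minus, hv])
  have h22 := @h .plus .vbar .plus .vbar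
    (by rw [plus_mul_vbar, smul_smul, inv_mul_cancel₀ hq, one_smul])
    (by rw [plus_mul_vbar, smul_smul, inv_mul_cancel₀ hq, one_smul])
    (by rw [plus_mul_minus, hv])
  simp only [plusPoly, Finset.sum_mul, add_mul, smul_mul_assoc, mul_assoc, map_sum, map_add,
    map_smul]
  refine Finset.sum_eq_zero fun i _ => ?_
  rw [Finset.sum_eq_zero, Finset.sum_eq_zero, map_mom_pow_mul_eq_zero hL, smul_zero, add_zero,
    add_zero]
  · exact map_mom_pow_mul_eq_zero hL h12 _ _
  · intro j _
    rw [map_mom_pow_mul_eq_zero hL, smul_zero]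
    exact map_mom_pow_mul_eq_zero hL (map_mom_pow_mul_eq_zero hL h22 _ _) _ _
  · intro j _
    rw [map_mom_pow_mul_eq_zero hL, smul_zero]
    exact map_mom_pow_mul_eq_zero hL (map_mom_pow_mul_eq_zero hL h11 _ _) _ _

theorem Iminus_minusPoly_mul_wave (hq : q ≠ 0)
    (hroot : ∀ N : ℕ, 0 < N → q ^ N = 1 → q = 1) (m s : ℕ) (r : Consts) :
    Iminus q 0 (minusPoly q m r * wave q s) = 0 := by
  have hL : ∀ κ, Commute (LinearMap.mulLeft ℂ (mom q κ)) (Iminus q 0) := fun κ =>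
    commute_Iminus (commute_mulLeft_mom_diagOp κ) (commute_mulLeft_mom_D κ)
      (commute_mulLeft_mom_M κ) 0
  have hv := vbar_mul_v (q := q)
  have hb : kmom q .vbar * kmom q .minus = q • (kmom q .minus * kmom q .vbar) := by
    rw [minus_mul_vbar, smul_smul, mul_inv_cancel₀ hq, one_smul]
  have h := @Iminus_linear_mul_linear_mul_wave q hq hroot s
  -- The pairs $(a,b)$ are now $(k_{\bar v},k_-)$ and $(k_+,k_v)$.
  have h11 := @h .vbar .minus .vbar .minus minus_mul_vbar (by rw [minus_mul_plus, hv]) hb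
  have h12 := @h .plus .v .vbar .minus
    (by rw [plus_mul_minus, smul_smul, inv_mul_cancel₀ hq, one_smul])
    (by rw [minus_mul_plus, hv]) hb
  have h22 := @h .plus .v .plus .v (v_mul_plus hq) (v_mul_plus hq) plus_mul_minus
  simp only [minusPoly, Finset.sum_mul, add_mul, smul_mul_assoc, mul_assoc, map_sum, map_add,
    map_smul]
  refine Finset.sum_eq_zero fun i _ => ?_
  rw [Finset.sum_eq_zero, Finset.sum_eq_zero, map_mom_pow_mul_eq_zero hL, smul_zero, add_zero,
    add_zero]
  · exact map_mom_pow_mul_eq_zero hL h12 _ _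
  · intro j _
    rw [map_mom_pow_mul_eq_zero hL, smul_zero]
    exact map_mom_pow_mul_eq_zero hL (map_mom_pow_mul_eq_zero hL h22 _ _) _ _
  · intro j _
    rw [map_mom_pow_mul_eq_zero hL, smul_zero]
    exact map_mom_pow_mul_eq_zero hL (map_mom_pow_mul_eq_zero hL h11 _ _) _ _

theorem exists_finset_plusTerm (p : ℕ → ℕ → Consts) (e : ℕ) :
    ∃ S : Finset (ℕ × ℕ), ∀ i ∉ S, momProj q e (plusTerm q p i) = 0 := by
  refine ⟨Finset.range (e + 1) ×ˢ Finset.range (e + 1), fun i hi => ?_⟩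
  rw [Finset.mem_product, Finset.mem_range, Finset.mem_range] at hi
  exact momHomogeneous_plusTerm p i e (by omega)

/-- The box is larger than the set $m+2+s=e$ that really contributes, but as a product it lets the
sum over pairs split into iterated sums. -/
theorem momProj_minusTerm_eq_zero (r : ℕ → ℕ → Consts) (e : ℕ) (i : ℕ × ℕ)
    (hi : i ∉ Finset.range (e + 1) ×ˢ Finset.range (e + 1)) :
    momProj q e (minusTerm q r i) = 0 := by
  rw [Finset.mem_product, Finset.mem_range, Finset.mem_range] at hi
  exact momHomogeneous_minusTerm r i e (by omega)

theorem Iplus_Fhplus (hq : q ≠ 0) (hroot : ∀ N : ℕ, 0 < N → q ^ N = 1 → q = 1)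
    (p : ℕ → ℕ → Consts) : Iplus q 0 (Fhplus q p) = 0 :=
  map_formalSum_eq_zero
    (fun e => commute_Iplus (commute_momProj_diagOp e) (commute_momProj_D e)
      (commute_momProj_M e) 0)
    (exists_finset_plusTerm p) fun i => by
      rw [plusTerm, map_smul, Iplus_plusPoly_mul_wave hq hroot, smul_zero]

theorem Iminus_Fhminus (hq : q ≠ 0) (hroot : ∀ N : ℕ, 0 < N → q ^ N = 1 → q = 1)
    (r : ℕ → ℕ → Consts) : Iminus q 0 (Fhminus q r) = 0 :=
  map_formalSum_eq_zero
    (fun e => commute_Iminus (commute_momProj_diagOp e) (commute_momProj_D e)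
      (commute_momProj_M e) 0)
    (fun e => ⟨_, momProj_minusTerm_eq_zero r e⟩) fun i => by
      rw [minusTerm, map_smul, Iminus_minusPoly_mul_wave hq hroot, smul_zero]

/-! ### Factorization through the `q`-plane wave -/

/-- The slack $e\le N$ allows one cutoff for all the smaller degrees that occur in a Cauchy product
of total degree $N$. -/
theorem momProj_expTerm_eq_zero {e N : ℕ} (he : e ≤ N) (s : ℕ) (hs : s ∉ Finset.range (N + 1)) :
    momProj q e (expTerm q s) = 0 := by
  rw [Finset.mem_range] at hs
  exact momHomogeneous_expTerm s e (by omega)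

theorem momProj_minusPoly_eq_zero (r : ℕ → Consts) {e N : ℕ} (he : e ≤ N) (m : ℕ)
    (hm : m ∉ Finset.range (N + 1)) : momProj q e (minusPoly q m (r m)) = 0 := by
  rw [Finset.mem_range] at hm
  exact momHomogeneous_minusPoly m (r m) e (by omega)

theorem momProj_minusPoly_mul_expq_eq_zero (r : ℕ → Consts) (e m : ℕ)
    (hm : m ∉ Finset.range (e + 1)) :
    momProj q e (minusPoly q m (r m) * expq q) = 0 := by
  rw [momProj_mul]
  refine Finset.sum_eq_zero fun x hx => ?_
  have hx := Finset.HasAntidiagonal.mem_antidiagonal.1 hx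
  rw [momProj_minusPoly_eq_zero r (by omega) m hm, zero_mul]

theorem minusTerm_eq_mul_expTerm (r : ℕ → Consts) (ms : ℕ × ℕ) :
    minusTerm q (fun m _ => r m) ms = minusPoly q ms.1 (r ms.1) * expTerm q ms.2 := by
  rw [minusTerm, expTerm, mul_smul_comm]

/-- In degree $e$ both sides are finite double sums over the box; splitting each product by degrees
allows the sum over $s$ to be moved inside onto the plane wave. -/
theorem Fhminus_eq_formalSum_mul_expq (r : ℕ → Consts) :
    Fhminus q (fun m _ => r m) = formalSum (fun m => minusPoly q m (r m) * expq q) := by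
  refine field_ext_momProj fun e => ?_
  rw [Fhminus, momProj_formalSum _ (momProj_minusTerm_eq_zero _ e),
    momProj_formalSum _ (momProj_minusPoly_mul_expq_eq_zero r e), Finset.sum_product]
  refine Finset.sum_congr rfl fun m _ => ?_
  simp only [minusTerm_eq_mul_expTerm, momProj_mul]
  rw [Finset.sum_comm]
  refine Finset.sum_congr rfl fun x hx => ?_
  have hx := Finset.HasAntidiagonal.mem_antidiagonal.1 hx
  rw [expq, momProj_formalSum (Finset.range (e + 1))
    (momProj_expTerm_eq_zero (by omega)), Finset.mul_sum]

theorem formalSum_mul_expq (r : ℕ → Consts) :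
    formalSum (fun m => minusPoly q m (r m) * expq q) =
      formalSum (fun m => minusPoly q m (r m)) * expq q := by
  refine field_ext_momProj fun e => ?_
  rw [momProj_formalSum _ (momProj_minusPoly_mul_expq_eq_zero r e), momProj_mul]
  simp only [momProj_mul]
  rw [Finset.sum_comm]
  refine Finset.sum_congr rfl fun x hx => ?_
  have hx := Finset.HasAntidiagonal.mem_antidiagonal.1 hx
  rw [momProj_formalSum (Finset.range (e + 1)) (momProj_minusPoly_eq_zero r (by omega)),
    Finset.sum_mul]

end

end QMaxwell

theorem mainTheorem1 (q : ℂ) (hq : ‖q‖ = 1) (hroot : ∀ N : ℕ, 0 < N → q ^ N = 1 → q = 1) :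
    (∀ p : ℕ → ℕ → QMaxwell.Consts,
      QMaxwell.FormallySummable (QMaxwell.plusTerm q p) ∧
        QMaxwell.Iplus q 0 (QMaxwell.Fhplus q p) = 0) ∧
    (∀ r : ℕ → ℕ → QMaxwell.Consts,
      QMaxwell.FormallySummable (QMaxwell.minusTerm q r) ∧
        QMaxwell.Iminus q 0 (QMaxwell.Fhminus q r) = 0) ∧
    (∀ r : ℕ → QMaxwell.Consts,
      QMaxwell.FormallySummable (QMaxwell.expTerm q) ∧
        QMaxwell.FormallySummable (fun m => QMaxwell.minusPoly q m (r m)) ∧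
        QMaxwell.FormallySummable (fun m => QMaxwell.minusPoly q m (r m) * QMaxwell.expq q) ∧
        QMaxwell.Fhminus q (fun m _ => r m) =
          QMaxwell.formalSum (fun m => QMaxwell.minusPoly q m (r m) * QMaxwell.expq q) ∧
        QMaxwell.Fhminus q (fun m _ => r m) =
          QMaxwell.formalSum (fun m => QMaxwell.minusPoly q m (r m)) * QMaxwell.expq q) := by
  have hq0 : q ≠ 0 := by
    rintro rfl
    simp at hq
  refine ⟨fun p => ⟨?_, QMaxwell.Iplus_Fhplus hq0 hroot p⟩,
    fun r => ⟨?_, QMaxwell.Iminus_Fhminus hq0 hroot r⟩, fun r => ⟨?_, ?_, ?_,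
      QMaxwell.Fhminus_eq_formalSum_mul_expq r,
      (QMaxwell.Fhminus_eq_formalSum_mul_expq r).trans (QMaxwell.formalSum_mul_expq r)⟩⟩
  · exact QMaxwell.formallySummable_of_momProj (QMaxwell.exists_finset_plusTerm p)
  · exact QMaxwell.formallySummable_of_momProj fun e => ⟨_, QMaxwell.momProj_minusTerm_eq_zero r e⟩
  · exact QMaxwell.formallySummable_of_momProj fun e =>
      ⟨_, QMaxwell.momProj_expTerm_eq_zero (le_refl e)⟩
  · exact QMaxwell.formallySummable_of_momProj fun e =>
      ⟨_, QMaxwell.momProj_minusPoly_eq_zero r (le_refl e)⟩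
  · exact QMaxwell.formallySummable_of_momProj fun e =>
      ⟨_, QMaxwell.momProj_minusPoly_mul_expq_eq_zero r e⟩
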